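/- \textbf{Setting.} A slotted wireless network has a finite set $\mathcal E$ of links with a symmetric, irreflexive interference relation ($\mathcal C_i$ is the set of links interfering with $i$) and a finite non-empty set $\mathcal M$ of job types; a type-$m$ job has $s_m\ge 1$ packets, $s^{\max}=\max_m s_m$. In slot $t$, $A_{mi}(t)\in[0,A_{mi}^{\max}]$ type-$m$ jobs arrive at link $i$; the vectors $A(t)$ are i.i.d. over $t$. Since jobs are counted, each $A_{mi}^{\max}$ is $0$ or at least $1$. The constants satisfy $\epsilon_{mi}>0$ and $d_{mi}^{\max}\ge\max\{A_{mi}^{\max},\epsilon_{mi}/s_m\}$. The utility $U:[0,\infty)\to[0,\infty)$ is non-decreasing, concave and differentiable, and $\beta>0$, $\beta>U'(0)$. A schedule is a set of links no two of which interfere. Decisions are the admissions $r_{mi}(t)\in[0,A_{mi}(t)]$, the drops $d_{mi}(t)\in[0,d_{mi}^{\max}]$, the scheduled links ($x_i(t)\in\{0,1\}$) and the service $\mu_{mi}(t)\in\{0,1\}$. All queues start empty and evolve by $$Q_{mi}(t+1)=\max\{Q_{mi}(t)-\mu_{mi}(t)-d_{mi}(t)s_m,0\}+r_{mi}(t)s_m,$$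 $$Y_{mi}(t+1)=\max\{Y_{mi}(t)-r_{mi}(t)s_m,0\}+\eta_{mi}(t)s_m,$$ $$Z_{mi}(t+1)=\max\{Z_{mi}(t)+\mathbf 1_{\{Q_{mi}(t)>0\}}(\epsilon_{mi}-\mu_{mi}(t))-d_{mi}(t)s_m-\mathbf 1_{\{Q_{mi}(t)=0\}},0\}.$$ Write $w_{mi}=Q_{mi}+Z_{mi}$ and $w_i=\max_m w_{mi}$. \textbf{Algorithm} (parameters $V>0$ and $T\ge s^{\max}$). In every slot, $\eta_{mi}(t)$ maximizes $V\,U(\eta s_m)-Y_{mi}(t)\,\eta s_m$ over $\eta\in[0,A_{mi}^{\max}]$; $r_{mi}(t)=A_{mi}(t)$ if $Y_{mi}(t)>Q_{mi}(t)$ and $r_{mi}(t)=0$ otherwise; $d_{mi}(t)=d_{mi}^{\max}$ if $w_{mi}(t)>V\beta$ and $d_{mi}(t)=0$ otherwise. The schedule is chosen at the slots $nT$ and kept for the super slot of $T$ slots. It is generated by the following CSMA Markov chain on schedules. Each link draws an independent uniform back-off among $W$ mini-slots and, unless it has heard an INTENT message of an interfering link in an earlier mini-slot, sends INTENT in its mini-slot;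 the links that send without a simultaneous INTENT of an interfering link form the control schedule. A link outside the control schedule keeps its state; a link in it becomes idle if an interfering link was active, and otherwise, independently, becomes active with probability $e^{w_i}/(1+e^{w_i})$ and idle with the remaining probability. Every link belongs to the control schedule with positive probability (which holds if $W\ge 2$). Time-scale separation is assumed: given the past, the schedule at slot $nT$ has a stationary distribution of this chain for the weights $w_i=w_i(nT)$; the arrivals in a slot are independent of the past. In each slot, an idle link does not transmit; an active link continues an unfinished job (a job, once started, occupies the link for $s_m$ consecutive slots), and otherwise serves a type of maximum weight $w_{mi}(t)$ among those for which $s_m$ slots are left in the super slot, or transmits nothing if there is no such type. Ties are broken arbitrarily. \textbf{Utilities.} For a sequence of decisions put $$\Psi_t=\sum_{m,i}\Big[U\Big(\tfrac{s_m}t\sum_{\tau<t}\mathbb E\,r_{mi}(\tau)\Big)-\beta\,\tfrac{s_m}t\sum_{\tau<t}\mathbb E\,d_{mi}(\tau)\Big],$$ and let $\Psi=\liminf_{t\to\infty}\Psi_t$ for the algorithm. For $0\le\nu<1$ let $\Psi^{*\nu}$ be the supremum of $\limsup_{t\to\infty}\Psi_t$ over all decision sequences, possibly depending on all past and future arrivals,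 with $r_{mi}(t)\in[0,A_{mi}(t)]$, $d_{mi}(t)\in[0,d_{mi}^{\max}]$, collision-free schedules, $\mu_{mi}(t)\in\{0,1\}$ and $\sum_m\mu_{mi}(t)=x_i(t)$, which use only the fraction $1-\nu$ of the capacity: the packet queues with service $(1-\nu)\mu_{mi}(t)$ in place of $\mu_{mi}(t)$ are strongly stable, i.e. $\limsup_t\frac1t\sum_{\tau<t}\mathbb E\,Q_{mi}(\tau)<\infty$, and the rate condition of the delay queues holds, $\epsilon_{mi}\le\liminf_t\frac1t\sum_{\tau<t}\mathbb E[(1-\nu)\mu_{mi}(\tau)+d_{mi}(\tau)s_m]$. Put $$B=\tfrac12\sum_{m,i}\big[3(A_{mi}^{\max}s_m)^2+2(1+d_{mi}^{\max}s_m)^2+\epsilon_{mi}^2\big],\qquad B'=\sum_{m,i}\big[(A_{mi}^{\max}+2d_{mi}^{\max})s_m+2\big],$$ $$B''=\sum_{m,i}\big[(A_{mi}^{\max}s_m)^2+\epsilon_{mi}^2+2d_{mi}^{\max}s_m(1+d_{mi}^{\max}s_m)\big].$$ \textbf{Theorem (utility-optimality).} (1) For all $\delta,\theta\in(0,1)$,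 with $\nu=1-\frac{(1-\delta)(1-\theta)(T-s^{\max}+1)}{T}$, $$\Psi\ \ge\ \Psi^{*\nu}-\frac{(T-1)B''}{2V}-\frac{B'(T-s^{\max}+1)(T-s^{\max})}{2VT}-\frac BV .$$ (2) Consequently the utility gets arbitrarily close to the full-capacity offline optimum as $V,T\to\infty$ with $T/V\to0$: for every $\kappa>0$ there are $V_0$, $T_0$ and $c>0$ such that $\Psi\ge\Psi^{*0}-\kappa$ whenever $V\ge V_0$, $T\ge T_0$ and $T/V\le c$. -/

import Mathlib

open MeasureTheory ProbabilityTheory Filter Set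

/-- A single-hop wireless network: `E` is the set of links, `M` the set of job types. -/
structure Network (M E : Type*) where
  /-- Symmetric interference relation: the neighbours of `i` form its collision set `C_i`. -/
  conflict : SimpleGraph E
  /-- Number of packets `s_m` of a job of type `m`. -/
  size : M → ℕ
  size_pos : ∀ m, 1 ≤ size m
  /-- Upper bound on the number of jobs arriving in one slot. -/
  Amax : M → E → ℝ
  /-- Arrivals are counted in jobs, so the bound is either zero or at least one job. -/
  Amax_jobs : ∀ m i, Amax m i = 0 ∨ 1 ≤ Amax m i
  /-- Maximum number of jobs dropped in one slot. -/
  dmax : M → E → ℝ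
  Amax_le_dmax : ∀ m i, Amax m i ≤ dmax m i
  /-- The constants of the delay virtual queues. -/
  eps : M → E → ℝ
  eps_pos : ∀ m i, 0 < eps m i
  eps_le_dmax : ∀ m i, eps m i / size m ≤ dmax m i
  /-- The throughput utility function on `[0, ∞)`. -/
  U : ℝ → ℝ
  U_nonneg : ∀ y, 0 ≤ y → 0 ≤ U y
  U_mono : MonotoneOn U (Ici 0)
  U_concave : ConcaveOn ℝ (Ici 0) U
  U_diff : DifferentiableOn ℝ U (Ici 0)
  /-- Penalty per dropped packet. -/
  β : ℝ
  β_pos : 0 < β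
  β_gt : derivWithin U (Ici 0) 0 < β

/-- The decisions on admission, dropping, link scheduling and job transmission, for every slot and
every outcome.  `serve t ω i = some m` means that link `i` serves a type-`m` job in slot `t`. -/
structure Policy (Ω M E : Type*) where
  /-- `r_mi(t)`, the number of admitted jobs. -/
  r : ℕ → Ω → M → E → ℝ
  /-- `d_mi(t)`, the number of dropped jobs. -/
  d : ℕ → Ω → M → E → ℝ
  /-- The set of scheduled links, `{i | x_i(t) = 1}`. -/
  x : ℕ → Ω → Finset E
  /-- The job type served by each link, if any. -/
  serve : ℕ → Ω → E → Option M

/-- `(1/t) ∑_{τ < t} 𝔼 f(τ)`. -/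
noncomputable def timeAvg {Ω : Type*} [MeasurableSpace Ω] (P : Measure Ω) (f : ℕ → Ω → ℝ)
    (t : ℕ) : ℝ :=
  (1 / (t : ℝ)) * ∑ τ ∈ Finset.range t, ∫ ω, f τ ω ∂P

namespace Policy

variable {Ω M E : Type*}

open Classical in
/-- `μ_mi(t) ∈ {0,1}`: is a type-`m` packet transmitted over link `i` in slot `t`? -/
noncomputable def mu (p : Policy Ω M E) (t : ℕ) (ω : Ω) (m : M) (i : E) : ℝ :=
  if p.serve t ω i = some m then 1 else 0

end Policy

namespace Network

variable {Ω M E : Type*}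

/-! ### Queues -/

/-- The packet queues `Q_mi(t)`, initially empty, where a transmission removes `c` packets
(`c = 1` for the actual network, `c = 1 - ν` when only this fraction of the capacity is used). -/
noncomputable def queueQ (N : Network M E) (c : ℝ) (p : Policy Ω M E) : ℕ → Ω → M → E → ℝ
  | 0 => fun _ _ _ => 0
  | t + 1 => fun ω m i =>
      max (N.queueQ c p t ω m i - c * p.mu t ω m i - p.d t ω m i * N.size m) 0
        + p.r t ω m i * N.size m

/-- The virtual queues `Y_mi(t)` for rate control, initially empty. -/
noncomputable def queueY (N : Network M E) (p : Policy Ω M E) (η : ℕ → Ω → M → E → ℝ) :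
    ℕ → Ω → M → E → ℝ
  | 0 => fun _ _ _ => 0
  | t + 1 => fun ω m i =>
      max (N.queueY p η t ω m i - p.r t ω m i * N.size m) 0 + η t ω m i * N.size m

open Classical in
/-- The virtual queues `Z_mi(t)` for the delay bound, initially empty. -/
noncomputable def queueZ (N : Network M E) (p : Policy Ω M E) : ℕ → Ω → M → E → ℝ
  | 0 => fun _ _ _ => 0
  | t + 1 => fun ω m i =>
      max (N.queueZ p t ω m i
        + (if 0 < N.queueQ 1 p t ω m i then N.eps m i - p.mu t ω m i else 0)
        - p.d t ω m i * N.size m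
        - (if N.queueQ 1 p t ω m i = 0 then 1 else 0)) 0

/-- `w_mi(t) = Q_mi(t) + Z_mi(t)`. -/
noncomputable def weight (N : Network M E) (p : Policy Ω M E) (t : ℕ) (ω : Ω) (m : M) (i : E) :
    ℝ :=
  N.queueQ 1 p t ω m i + N.queueZ p t ω m i

/-- `w_i(t) = max_m w_mi(t)`. -/
noncomputable def linkWeight [Fintype M] [Nonempty M] (N : Network M E) (p : Policy Ω M E)
    (t : ℕ) (ω : Ω) (i : E) : ℝ :=
  Finset.univ.sup' Finset.univ_nonempty (fun m => N.weight p t ω m i)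

/-! ### The CSMA Markov chain -/

/-- Collision-free sets of links. -/
def Feasible (N : Network M E) (χ : Finset E) : Prop :=
  ∀ i ∈ χ, ∀ j ∈ χ, ¬ N.conflict.Adj i j

/-- The links that have sent an `INTENT` message in one of the first `k` mini-slots, when `b` are
the back-off times: link `i` sends in mini-slot number `b i` (counted from zero) unless it has
heard an `INTENT` message of an interfering link before. -/
def intents (N : Network M E) (b : E → ℕ) : ℕ → Set E
  | 0 => ∅
  | k + 1 => N.intents b k ∪ {i | b i = k ∧ ∀ j, N.conflict.Adj i j → j ∉ N.intents b k}

/-- The control schedule `{i | z_i = 1}`: link `i` has not heard an `INTENT` message before its own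
mini-slot, and its own message does not collide with one of an interfering link. -/
def control (N : Network M E) (b : E → ℕ) : Set E :=
  {i | (∀ j, N.conflict.Adj i j → j ∉ N.intents b (b i)) ∧
       ∀ j, N.conflict.Adj i j → j ∉ N.intents b (b i + 1)}

open Classical in
/-- The probability that link `i` takes the state it has in `χ'` in the scheduling phase, when `χ`
is the previous schedule, `z` the control schedule, and `w` are the link weights. -/
noncomputable def linkStep (N : Network M E) (w : E → ℝ) (z : Set E) (χ χ' : Finset E) (i : E) :
    ℝ :=
  if i ∈ z then
    if ∃ j ∈ χ, N.conflict.Adj i j then (if i ∈ χ' then 0 else 1)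
    else if i ∈ χ' then Real.exp (w i) / (1 + Real.exp (w i))
    else 1 - Real.exp (w i) / (1 + Real.exp (w i))
  else if (i ∈ χ' ↔ i ∈ χ) then 1 else 0

open Classical in
/-- Transition probabilities of the CSMA schedule for frozen weights `w`: the back-off times are
independent and uniform on `W` mini-slots, then all links update independently. -/
noncomputable def csmaKernel [Fintype E] (N : Network M E) (W : ℕ) (w : E → ℝ)
    (χ χ' : Finset E) : ℝ :=
  (1 / (W : ℝ) ^ Fintype.card E) *
    ∑ b : E → Fin W, ∏ i, N.linkStep w (N.control (fun j => (b j : ℕ))) χ χ' i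

/-- `π` is a stationary distribution, on the collision-free schedules, of the CSMA chain. -/
def IsStationary [Fintype E] (N : Network M E) (W : ℕ) (w : E → ℝ) (π : Finset E → ℝ) : Prop :=
  (∀ χ, 0 ≤ π χ) ∧ ∑ χ, π χ = 1 ∧ (∀ χ, ¬ N.Feasible χ → π χ = 0) ∧
    ∀ χ', ∑ χ, π χ * N.csmaKernel W w χ χ' = π χ'

/-! ### The algorithm -/

/-- The number of slots that the job under transmission on link `i` still needs at the beginning of
slot `t`; a type-`m` job occupies its link for `size m` consecutive slots.  A positive value means
that the previously scheduled job is unfinished.  Super slots consist of `T` slots and start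
afresh. -/
def left (N : Network M E) (T : ℕ) (p : Policy Ω M E) : ℕ → Ω → E → ℕ
  | 0 => fun _ _ => 0
  | t + 1 => fun ω i =>
      if T ∣ t + 1 then 0
      else match p.serve t ω i with
        | none => 0
        | some m => if 0 < N.left T p t ω i then N.left T p t ω i - 1 else N.size m - 1

/-- A type-`m` job started in slot `t` is finished by the end of the current super slot. -/
def Fits (N : Network M E) (T t : ℕ) (m : M) : Prop :=
  t + N.size m ≤ (t / T + 1) * T

/-- The largest job size `s^max`. -/
def maxSize [Fintype M] (N : Network M E) : ℕ := Finset.univ.sup N.size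

/-- The arrivals `A_mi(t)`: bounded, and i.i.d. over the slots. -/
structure IsArrivals [MeasurableSpace Ω] (N : Network M E) (P : Measure Ω)
    (A : ℕ → Ω → M → E → ℝ) : Prop where
  measurable : ∀ t, Measurable (A t)
  nonneg : ∀ t ω m i, 0 ≤ A t ω m i
  le_max : ∀ t ω m i, A t ω m i ≤ N.Amax m i
  indep : iIndepFun A P
  ident : ∀ t, IdentDistrib (A t) (A 0) P P

open Classical in
/-- `p` (with auxiliary variables `η`) is a run of the dynamic net utility maximization algorithm
with parameter `V`, super slots of `T` slots, and `W` mini-slots in the control phase.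
`ℱ t` is the information available at the beginning of slot `t`. -/
structure IsRun [Fintype M] [Nonempty M] [Fintype E] [mΩ : MeasurableSpace Ω] (N : Network M E)
    (P : Measure Ω) (A : ℕ → Ω → M → E → ℝ) (W : ℕ) (V : ℝ) (T : ℕ) (ℱ : Filtration ℕ mΩ)
    (p : Policy Ω M E) (η : ℕ → Ω → M → E → ℝ) : Prop where
  arrival_adapted : ∀ t, Measurable[ℱ (t + 1)] (A t)
  arrival_indep : ∀ t, Indep (ℱ t) (MeasurableSpace.comap (A t) inferInstance) P
  aux_adapted : ∀ t, Measurable[ℱ (t + 1)] (η t)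
  schedule_adapted : ∀ t χ, MeasurableSet[ℱ (t + 1)] {ω | p.x t ω = χ}
  serve_adapted : ∀ t i o, MeasurableSet[ℱ (t + 1)] {ω | p.serve t ω i = o}
  /-- The auxiliary variable maximizes `V U(η s_m) - Y_mi(t) η s_m` over `[0, A_mi^max]`. -/
  aux_mem : ∀ t ω m i, η t ω m i ∈ Icc 0 (N.Amax m i)
  aux_max : ∀ t ω m i, ∀ y ∈ Icc 0 (N.Amax m i),
    V * N.U (y * N.size m) - N.queueY p η t ω m i * (y * N.size m) ≤
      V * N.U (η t ω m i * N.size m) - N.queueY p η t ω m i * (η t ω m i * N.size m)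
  /-- Rate control. -/
  admission : ∀ t ω m i, p.r t ω m i =
    if 0 < N.queueY p η t ω m i - N.queueQ 1 p t ω m i then A t ω m i else 0
  /-- Job dropping. -/
  drop : ∀ t ω m i, p.d t ω m i =
    if V * N.β < N.queueQ 1 p t ω m i + N.queueZ p t ω m i then N.dmax m i else 0
  /-- Link scheduling under time-scale separation: at the beginning of each super slot, the
  schedule has, given the past, a stationary law of the CSMA chain for the current weights. -/
  schedule_law : ∀ n, ∀ᵐ ω ∂P, N.IsStationary W (N.linkWeight p (n * T) ω)
    (fun χ => (P[({ω' | p.x (n * T) ω' = χ}.indicator fun _ => (1 : ℝ)) | ℱ (n * T)]) ω)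
  /-- The schedule is kept during a super slot. -/
  schedule_fixed : ∀ t ω, p.x t ω = p.x (t / T * T) ω
  /-- Links that are not scheduled do not transmit. -/
  serve_idle : ∀ t ω i, i ∉ p.x t ω → p.serve t ω i = none
  /-- An unfinished job is continued. -/
  serve_continue : ∀ t ω i, i ∈ p.x t ω → 0 < N.left T p t ω i →
    p.serve t ω i = p.serve (t - 1) ω i
  /-- Otherwise a type of maximum weight is served, among those that can be finished within the
  super slot; a link does not transmit if there is no such type. -/
  serve_max : ∀ t ω i, i ∈ p.x t ω → N.left T p t ω i = 0 → ∀ m, p.serve t ω i = some m →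
    N.Fits T t m ∧ ∀ m', N.Fits T t m' → N.weight p t ω m' i ≤ N.weight p t ω m i
  serve_none : ∀ t ω i, i ∈ p.x t ω → N.left T p t ω i = 0 → p.serve t ω i = none →
    ∀ m, ¬ N.Fits T t m

/-! ### Utilities and the offline optimum -/

/-- The net utility of the average rates over the first `t` slots,
`∑ U(r̄_mi s_m) - β d̄_mi s_m`. -/
noncomputable def horizonUtility [Fintype M] [Fintype E] [MeasurableSpace Ω] (N : Network M E)
    (P : Measure Ω) (p : Policy Ω M E) (t : ℕ) : ℝ :=
  ∑ m, ∑ i, (N.U (timeAvg P (fun τ ω => p.r τ ω m i) t * N.size m)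
    - N.β * timeAvg P (fun τ ω => p.d τ ω m i) t * N.size m)

/-- The time-averaged net utility `Ψ` of the algorithm.  Limits are not presupposed to exist; the
lower limit is used here, and the upper limit for the offline policies. -/
noncomputable def netUtility [Fintype M] [Fintype E] [MeasurableSpace Ω] (N : Network M E)
    (P : Measure Ω) (p : Policy Ω M E) : ℝ :=
  liminf (N.horizonUtility P p) atTop

open Classical in
/-- The policies available offline when a fraction `1 - ν` of the capacity region may be used.
There is no causality requirement: decisions may depend on all past and future arrivals. -/
structure IsOffline [Fintype M] [MeasurableSpace Ω] (N : Network M E) (P : Measure Ω)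
    (A : ℕ → Ω → M → E → ℝ) (ν : ℝ) (p : Policy Ω M E) : Prop where
  measurable_r : ∀ t m i, Measurable fun ω => p.r t ω m i
  measurable_d : ∀ t m i, Measurable fun ω => p.d t ω m i
  measurable_x : ∀ t χ, MeasurableSet {ω | p.x t ω = χ}
  measurable_serve : ∀ t i o, MeasurableSet {ω | p.serve t ω i = o}
  admission : ∀ t ω m i, p.r t ω m i ∈ Icc 0 (A t ω m i)
  drop : ∀ t ω m i, p.d t ω m i ∈ Icc 0 (N.dmax m i)
  collision_free : ∀ t ω, N.Feasible (p.x t ω)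
  unit_capacity : ∀ t ω i, ∑ m, p.mu t ω m i = if i ∈ p.x t ω then 1 else 0
  /-- Strong stability of the packet queues: `limsup (1/t) ∑_{τ<t} 𝔼 Q_mi(τ) < ∞`. -/
  stable : ∀ m i, IsBoundedUnder (· ≤ ·) atTop
    (timeAvg P fun τ ω => N.queueQ (1 - ν) p τ ω m i)
  /-- The rate condition of the delay virtual queues, `ε_mi ≤ μ̄_mi + d̄_mi s_m`. -/
  persistent : ∀ m i, N.eps m i ≤
    liminf (timeAvg P fun τ ω => (1 - ν) * p.mu τ ω m i + p.d τ ω m i * N.size m) atTop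

/-- The offline optimum `Ψ^{*ν}`. -/
noncomputable def offlineOpt [Fintype M] [Fintype E] [MeasurableSpace Ω] (N : Network M E)
    (P : Measure Ω) (A : ℕ → Ω → M → E → ℝ) (ν : ℝ) : ℝ :=
  sSup {u | ∃ p : Policy Ω M E, N.IsOffline P A ν p ∧
    u = limsup (N.horizonUtility P p) atTop}

/-! ### Constants -/

/-- The constant `B`. -/
noncomputable def B [Fintype M] [Fintype E] (N : Network M E) : ℝ :=
  1 / 2 * ∑ m, ∑ i, (3 * (N.Amax m i * N.size m) ^ 2 + 2 * (1 + N.dmax m i * N.size m) ^ 2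
    + N.eps m i ^ 2)

/-- The constant `B'`. -/
noncomputable def B' [Fintype M] [Fintype E] (N : Network M E) : ℝ :=
  ∑ i, ∑ m, ((N.Amax m i + 2 * N.dmax m i) * N.size m + 2)

/-- The constant `B''`. -/
noncomputable def B'' [Fintype M] [Fintype E] (N : Network M E) : ℝ :=
  ∑ m, ∑ i, ((N.Amax m i * N.size m) ^ 2 + N.eps m i ^ 2
    + 2 * N.dmax m i * N.size m * (1 + N.dmax m i * N.size m))

end Network

/-!
The proof is a Lyapunov drift argument.  The schedule is only good in distribution and the margins
are explicit, so two points need care.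

*Comparison with rates instead of policies.*  An offline policy enters only through its average
admission, drop and service rates (`IsRatePoint`).  After a long time these rates are feasible up to
a small slack, because strongly stable queues grow sublinearly (`IsOffline.eventually_isRatePoint`),
and the slack, as well as a reduction of the capacity, can be bought off by dropping slightly more
jobs (`IsRatePoint.exists_drop`).  No limit of rates has to be taken.  Future arrivals are of no use
either: admission in the algorithm minimizes `(Q - Y) r` slot by slot and the arrivals are
independent of the queues, so every constant rate up to the mean arrivals does at most as well
(`IsRun.integral_admission_nonpos`).

*Service.*  A stationary law of the CSMA chain is the Gibbs law `exp (∑ w_i)`: the chain is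
reversible and all links can be switched off one by one, so that a harmonic density is constant
(`IsStationary.eq_gibbs`).  By the Gibbs variational principle the expected weight of the schedule
falls short of the maximum by at most its entropy, hence by at most the number of links
(`IsStationary.weight_le`).  This additive loss does not appear in the claimed bound.  It is
absorbed by the constant `B`: the two increments of a queue have opposite signs, so that only the
larger of their squares counts (`max_sub_add_sq_le`).  This gains at least one unit for each pair of
a link and a job type with arrivals, and without arrivals all queues of the pair stay empty
(`IsRun.pair_drift`).

Within a super slot the weights move by a bounded amount per slot, and in its first
`T - s^max + 1` slots a scheduled link always serves a type whose weight is nearly maximal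
(`IsRun.exists_serve`).  Summing the drift over a super slot (`IsRun.superslot_drift`), Jensen's
inequality and the boundedness of the queues `Y` bound the utility of the algorithm from below by
that of any feasible rates (`IsRun.netUtility_ge`), and thereby by the offline optimum
(`IsRun.offlineOpt_le`).
-/

/-! ### The stationary law of the CSMA chain -/

namespace Network

variable {Ω M E : Type*}

theorem intents_monotone (N : Network M E) (b : E → ℕ) : Monotone (N.intents b) :=
  monotone_nat_of_le_succ fun _ => subset_union_left

/-- The control schedule is collision-free: of two interfering links, the one that sends first is
heard by the other. -/
theorem not_adj_of_mem_control (N : Network M E) {b : E → ℕ} {i j : E} (hi : i ∈ N.control b)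
    (hj : j ∈ N.control b) : ¬ N.conflict.Adj i j := by
  intro hij
  wlog hb : b i ≤ b j generalizing i j
  · exact this hj hi hij.symm (le_of_not_ge hb)
  have h1 : i ∈ N.intents b (b i + 1) := Or.inr ⟨rfl, hi.1⟩
  exact hj.2 i hij.symm (N.intents_monotone b (by omega) h1)

theorem feasible_empty (N : Network M E) : N.Feasible ∅ := by
  intro i hi
  simp at hi

theorem linkStep_nonneg (N : Network M E) (w : E → ℝ) (z : Set E) (χ χ' : Finset E) (i : E) :
    0 ≤ N.linkStep w z χ χ' i := by
  have h : Real.exp (w i) / (1 + Real.exp (w i)) ≤ 1 := by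
    rw [div_le_one (by positivity)]; linarith
  unfold linkStep
  split_ifs <;> positivity

open Classical in
theorem sum_prod_linkStep [Fintype E] (N : Network M E) (w : E → ℝ) (z : Set E) (χ : Finset E) :
    ∑ χ' : Finset E, ∏ i, N.linkStep w z χ χ' i = 1 := by
  have h1 : ∀ χ' : Finset E, ∏ i, N.linkStep w z χ χ' i =
      (∏ i ∈ χ', N.linkStep w z χ Finset.univ i) *
        ∏ i ∈ Finset.univ \ χ', N.linkStep w z χ ∅ i := by
    intro χ'
    rw [← Finset.prod_sdiff (Finset.subset_univ χ'), mul_comm]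
    congr 1
    · refine Finset.prod_congr rfl fun i hi => ?_
      simp [linkStep, hi]
    · refine Finset.prod_congr rfl fun i hi => ?_
      have : i ∉ χ' := by simpa using hi
      simp [linkStep, this]
  simp_rw [h1]
  rw [← Finset.powerset_univ, ← Finset.prod_add]
  refine Finset.prod_eq_one fun i _ => ?_
  unfold linkStep
  by_cases hz : i ∈ z <;> by_cases hb : ∃ j ∈ χ, N.conflict.Adj i j <;> by_cases hi : i ∈ χ <;>
    simp [hz, hb, hi]

/-- The unnormalized Gibbs weight of a schedule. -/
noncomputable def gibbs (w : E → ℝ) (χ : Finset E) : ℝ := Real.exp (∑ i ∈ χ, w i)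

open Classical in
theorem gibbs_eq_prod [Fintype E] (w : E → ℝ) (χ : Finset E) :
    gibbs w χ = ∏ i, if i ∈ χ then Real.exp (w i) else 1 := by
  rw [gibbs, Real.exp_sum, Finset.prod_ite]
  simp

open Classical in
theorem prod_linkStep_eq_zero [Fintype E] (N : Network M E) (w : E → ℝ) {z : Set E}
    {χ χ' : Finset E} {i : E} (hi : i ∉ z) (h : ¬ (i ∈ χ' ↔ i ∈ χ)) :
    ∏ i, N.linkStep w z χ χ' i = 0 :=
  Finset.prod_eq_zero (Finset.mem_univ i) (by simp [linkStep, hi, h])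

theorem linkStep_detailed_balance (N : Network M E) (w : E → ℝ) {z : Set E}
    (hz : ∀ i ∈ z, ∀ j ∈ z, ¬ N.conflict.Adj i j) {χ χ' : Finset E} (hχ : N.Feasible χ)
    (hχ' : N.Feasible χ') (h : ∀ i, i ∉ z → (i ∈ χ' ↔ i ∈ χ)) (i : E) [Decidable (i ∈ χ)]
    [Decidable (i ∈ χ')] :
    (if i ∈ χ then Real.exp (w i) else 1) * N.linkStep w z χ χ' i =
      (if i ∈ χ' then Real.exp (w i) else 1) * N.linkStep w z χ' χ i := by
  by_cases hi : i ∈ z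
  · -- the neighbours of `i` are outside of the control schedule, hence keep their states
    have hb : (∃ j ∈ χ', N.conflict.Adj i j) ↔ ∃ j ∈ χ, N.conflict.Adj i j := by
      exact exists_congr fun j => and_congr_left fun hij => h j fun hj => hz i hi j hj hij
    by_cases hc : ∃ j ∈ χ, N.conflict.Adj i j
    · have h1 : i ∉ χ := fun h1 => by
        obtain ⟨j, hj, hij⟩ := hc
        exact hχ i h1 j hj hij
      have h2 : i ∉ χ' := fun h2 => by
        obtain ⟨j, hj, hij⟩ := hb.2 hc
        exact hχ' i h2 j hj hij
      simp [linkStep, hi, hb, hc, h1, h2]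
    · have h0 : (1 + Real.exp (w i)) ≠ 0 := by positivity
      by_cases h1 : i ∈ χ <;> by_cases h2 : i ∈ χ' <;> simp [linkStep, hi, hb, hc, h1, h2] <;>
        field_simp <;> ring
  · have := h i hi
    by_cases h1 : i ∈ χ <;> simp [linkStep, hi, this, h1]

theorem csmaKernel_detailed_balance [Fintype E] (N : Network M E) (W : ℕ) (w : E → ℝ)
    {χ χ' : Finset E} (hχ : N.Feasible χ) (hχ' : N.Feasible χ') :
    gibbs w χ * N.csmaKernel W w χ χ' = gibbs w χ' * N.csmaKernel W w χ' χ := by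
  classical
  unfold csmaKernel
  rw [mul_left_comm, mul_left_comm (gibbs w χ'), Finset.mul_sum _ _ (gibbs w χ),
    Finset.mul_sum _ _ (gibbs w χ')]
  congr 1
  refine Finset.sum_congr rfl fun b _ => ?_
  set z := N.control fun j => (b j : ℕ)
  by_cases h : ∀ i, i ∉ z → (i ∈ χ' ↔ i ∈ χ)
  · rw [gibbs_eq_prod, gibbs_eq_prod, ← Finset.prod_mul_distrib, ← Finset.prod_mul_distrib]
    exact Finset.prod_congr rfl fun i _ => N.linkStep_detailed_balance w
      (fun i hi j hj => N.not_adj_of_mem_control hi hj) hχ hχ' h i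
  · push Not at h
    obtain ⟨i, hi, h⟩ := h
    have h' : ¬ (i ∈ χ' ↔ i ∈ χ) := by tauto
    rw [N.prod_linkStep_eq_zero w hi h', N.prod_linkStep_eq_zero w hi fun h => h' h.symm]
    simp

theorem csmaKernel_nonneg [Fintype E] (N : Network M E) (W : ℕ) (w : E → ℝ) (χ χ' : Finset E) :
    0 ≤ N.csmaKernel W w χ χ' :=
  mul_nonneg (by positivity) (Finset.sum_nonneg fun _ _ =>
    Finset.prod_nonneg fun _ _ => N.linkStep_nonneg _ _ _ _ _)

/-- The CSMA chain never leaves the collision-free schedules. -/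
theorem csmaKernel_eq_zero [Fintype E] (N : Network M E) (W : ℕ) (w : E → ℝ)
    {χ χ' : Finset E} (hχ : N.Feasible χ) (hχ' : ¬ N.Feasible χ') :
    N.csmaKernel W w χ χ' = 0 := by
  classical
  unfold csmaKernel
  rw [Finset.sum_eq_zero, mul_zero]
  intro b _
  set z := N.control fun j => (b j : ℕ)
  by_contra h0
  have hoff : ∀ i, i ∉ z → (i ∈ χ' ↔ i ∈ χ) := fun i hi => by
    by_contra h
    exact h0 (N.prod_linkStep_eq_zero w hi h)
  have key : ∀ i ∈ χ', ∀ j ∈ χ', i ∈ z → N.conflict.Adj i j → False := by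
    intro i hi j hj hiz hij
    have hjz : j ∉ z := fun hjz => N.not_adj_of_mem_control hiz hjz hij
    have hb : ∃ j ∈ χ, N.conflict.Adj i j := ⟨j, (hoff j hjz).1 hj, hij⟩
    exact h0 (Finset.prod_eq_zero (Finset.mem_univ i) (by
      simp only [linkStep, if_pos hiz, if_pos hb, if_pos hi]))
  refine hχ' fun i hi j hj hij => ?_
  by_cases hiz : i ∈ z
  · exact key i hi j hj hiz hij
  by_cases hjz : j ∈ z
  · exact key j hj i hi hjz hij.symm
  exact hχ i ((hoff i hiz).1 hi) j ((hoff j hjz).1 hj) hij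

theorem pow_card_ne_zero [Fintype E] {N : Network M E} {W : ℕ}
    (hW : ∀ i : E, ∃ b : E → Fin W, i ∈ N.control (fun j => (b j : ℕ))) :
    (W : ℝ) ^ Fintype.card E ≠ 0 := by
  rcases isEmpty_or_nonempty E with h | ⟨⟨i⟩⟩
  · simp
  · obtain ⟨b, -⟩ := hW i
    have : W ≠ 0 := fun h => by subst h; exact (b i).elim0
    positivity

theorem sum_csmaKernel [Fintype E] {N : Network M E} {W : ℕ}
    (hW : ∀ i : E, ∃ b : E → Fin W, i ∈ N.control (fun j => (b j : ℕ))) (w : E → ℝ)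
    (χ : Finset E) : ∑ χ', N.csmaKernel W w χ χ' = 1 := by
  classical
  unfold csmaKernel
  rw [← Finset.mul_sum, Finset.sum_comm]
  simp_rw [sum_prod_linkStep]
  have := pow_card_ne_zero hW
  simp only [Finset.sum_const, Finset.card_univ, Fintype.card_fun, Fintype.card_fin, nsmul_eq_mul,
    Nat.cast_pow, mul_one]
  field_simp

open Classical in
/-- Any single active link may be switched off. -/
theorem csmaKernel_erase_pos [Fintype E] {N : Network M E} {W : ℕ}
    (hW : ∀ i : E, ∃ b : E → Fin W, i ∈ N.control (fun j => (b j : ℕ))) (w : E → ℝ)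
    {χ : Finset E} (hχ : N.Feasible χ) (i : E) :
    0 < N.csmaKernel W w χ (χ.erase i) := by
  have h0 : (W : ℝ) ^ Fintype.card E ≠ 0 := pow_card_ne_zero hW
  unfold csmaKernel
  refine mul_pos (by positivity) ?_
  obtain ⟨b, hb⟩ := hW i
  refine Finset.sum_pos' (fun _ _ => Finset.prod_nonneg fun _ _ => N.linkStep_nonneg _ _ _ _ _)
    ⟨b, Finset.mem_univ _, Finset.prod_pos fun j _ => ?_⟩
  unfold linkStep
  have h1 : Real.exp (w j) / (1 + Real.exp (w j)) < 1 := by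
    rw [div_lt_one (by positivity)]; linarith
  by_cases hj : j ∈ N.control fun j => (b j : ℕ)
  · by_cases hc : ∃ k ∈ χ, N.conflict.Adj j k
    · have hjχ : j ∉ χ := fun h => by
        obtain ⟨k, hk, hjk⟩ := hc
        exact hχ j h k hk hjk
      rw [if_pos hj, if_pos hc, if_neg fun h => hjχ (Finset.mem_of_mem_erase h)]
      exact one_pos
    · rw [if_pos hj, if_neg hc]
      split_ifs
      · positivity
      · linarith
  · have hji : j ≠ i := fun h => hj (h ▸ hb)
    rw [if_neg hj, if_pos (by simp [hji])]
    exact one_pos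

/-- Maximum principle for functions that are harmonic for the CSMA chain: since all links can be
switched off one after the other, a maximum is attained at the empty schedule. -/
theorem harmonic_empty_eq [Fintype E] {N : Network M E} {W : ℕ}
    (hW : ∀ i : E, ∃ b : E → Fin W, i ∈ N.control (fun j => (b j : ℕ))) (w : E → ℝ)
    {f : Finset E → ℝ} (hf : ∀ χ, N.Feasible χ → ∑ χ', N.csmaKernel W w χ χ' * f χ' = f χ)
    {C : ℝ} (hC : ∀ χ, N.Feasible χ → f χ ≤ C) {χ : Finset E} (hχ : N.Feasible χ)
    (h : f χ = C) : f ∅ = C := by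
  classical
  induction χ using Finset.strongInduction with
  | H χ ih =>
    rcases χ.eq_empty_or_nonempty with rfl | ⟨i, hi⟩
    · exact h
    have hfe : N.Feasible (χ.erase i) := fun j hj k hk =>
      hχ j (Finset.mem_of_mem_erase hj) k (Finset.mem_of_mem_erase hk)
    refine ih _ (Finset.erase_ssubset hi) hfe ?_
    have h0 : ∑ χ', N.csmaKernel W w χ χ' * (C - f χ') = 0 := by
      simp_rw [mul_sub]
      rw [Finset.sum_sub_distrib, hf χ hχ, ← Finset.sum_mul, sum_csmaKernel hW, h]
      ring
    have hnn : ∀ χ' ∈ Finset.univ, 0 ≤ N.csmaKernel W w χ χ' * (C - f χ') := by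
      intro χ' _
      by_cases hχ' : N.Feasible χ'
      · exact mul_nonneg (N.csmaKernel_nonneg _ _ _ _) (sub_nonneg.2 (hC _ hχ'))
      · rw [N.csmaKernel_eq_zero W w hχ hχ', zero_mul]
    have h1 := (Finset.sum_eq_zero_iff_of_nonneg hnn).1 h0 (χ.erase i) (Finset.mem_univ _)
    have h2 := (mul_eq_zero.1 h1).resolve_left (csmaKernel_erase_pos hW w hχ i).ne'
    linarith

/-- A stationary distribution of the CSMA chain is the Gibbs distribution: its density with
respect to the Gibbs weights is harmonic by detailed balance, hence constant. -/
theorem IsStationary.eq_gibbs [Fintype E] {N : Network M E} {W : ℕ}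
    (hW : ∀ i : E, ∃ b : E → Fin W, i ∈ N.control (fun j => (b j : ℕ))) {w : E → ℝ}
    {π : Finset E → ℝ} (hπ : N.IsStationary W w π) {χ : Finset E} (hχ : N.Feasible χ) :
    π χ = π ∅ * gibbs w χ := by
  classical
  obtain ⟨-, -, hsupp, hstat⟩ := hπ
  have hg : ∀ χ, 0 < gibbs w χ := fun χ => Real.exp_pos _
  set f : Finset E → ℝ := fun χ => π χ / gibbs w χ
  have hf : ∀ χ, N.Feasible χ → ∑ χ', N.csmaKernel W w χ χ' * f χ' = f χ := by
    intro χ hχ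
    rw [eq_div_iff (hg χ).ne', ← hstat χ, Finset.sum_mul]
    refine Finset.sum_congr rfl fun χ' _ => ?_
    by_cases hχ' : N.Feasible χ'
    · have := N.csmaKernel_detailed_balance W w hχ hχ'
      have h1 := (hg χ').ne'
      simp only [f]
      field_simp
      linear_combination π χ' * this
    · simp [f, hsupp χ' hχ']
  let F : Finset (Finset E) := Finset.univ.filter N.Feasible
  have hF : ∀ {χ}, χ ∈ F ↔ N.Feasible χ := by simp [F]
  have hne : F.Nonempty := ⟨∅, hF.2 N.feasible_empty⟩
  obtain ⟨χ₁, h₁, hmax⟩ := F.exists_max_image f hne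
  obtain ⟨χ₂, h₂, hmin⟩ := F.exists_min_image f hne
  have e₁ : f ∅ = f χ₁ :=
    harmonic_empty_eq hW w hf (fun χ hχ => hmax χ (hF.2 hχ)) (hF.1 h₁) rfl
  have e₂ : -f ∅ = -f χ₂ :=
    harmonic_empty_eq hW w (f := fun χ => -f χ)
      (fun χ hχ => by simp only [mul_neg, Finset.sum_neg_distrib, hf χ hχ])
      (fun χ hχ => neg_le_neg (hmin χ (hF.2 hχ))) (hF.1 h₂) rfl
  have h3 : f χ = f ∅ :=
    le_antisymm (e₁ ▸ hmax χ (hF.2 hχ)) (by linarith [hmin χ (hF.2 hχ)])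
  have h4 : f ∅ = π ∅ := by simp [f, gibbs]
  rw [← h4, ← h3, div_mul_cancel₀ _ (hg χ).ne']

/-- Under a stationary law of the CSMA chain, the expected weight of the schedule falls short of the
maximum weight by at most the entropy of the law, which is at most the number of links. -/
theorem IsStationary.weight_le [Fintype E] {N : Network M E} {W : ℕ}
    (hW : ∀ i : E, ∃ b : E → Fin W, i ∈ N.control (fun j => (b j : ℕ))) {w : E → ℝ}
    {π : Finset E → ℝ} (hπ : N.IsStationary W w π) {χ₀ : Finset E} (hχ₀ : N.Feasible χ₀) :
    ∑ i ∈ χ₀, w i ≤ ∑ χ, π χ * ∑ i ∈ χ, w i + Fintype.card E := by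
  classical
  have hg : ∀ χ, N.Feasible χ → π χ = π ∅ * gibbs w χ := fun χ hχ => hπ.eq_gibbs hW hχ
  obtain ⟨hnn, hsum, hsupp, -⟩ := hπ
  set L : ℝ := (Fintype.card E : ℝ)
  set w₀ := ∑ i ∈ χ₀, w i
  let F : Finset (Finset E) := Finset.univ.filter N.Feasible
  have hF : ∀ {χ}, χ ∈ F ↔ N.Feasible χ := by simp [F]
  have hsub : ∀ f : Finset E → ℝ, ∑ χ, π χ * f χ = π ∅ * ∑ χ ∈ F, gibbs w χ * f χ := by
    intro f
    rw [Finset.mul_sum, ← Finset.sum_subset (Finset.subset_univ F)]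
    · exact Finset.sum_congr rfl fun χ hχ => by rw [hg χ (hF.1 hχ), mul_assoc]
    · intro χ _ hχ
      rw [hsupp χ fun h => hχ (hF.2 h), zero_mul]
  have hcard : (F.card : ℝ) * Real.exp (-L) ≤ 1 := by
    have h1 : (F.card : ℝ) ≤ 2 ^ Fintype.card E := by
      have := Finset.card_le_univ F
      rw [Fintype.card_finset] at this
      exact_mod_cast this
    have h2 : (2 : ℝ) ^ Fintype.card E ≤ Real.exp L := by
      have h3 : (2 : ℝ) ≤ Real.exp 1 := by linarith [Real.add_one_le_exp 1]
      calc (2 : ℝ) ^ Fintype.card E ≤ Real.exp 1 ^ Fintype.card E := by gcongr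
        _ = Real.exp L := by rw [← Real.exp_nat_mul, mul_one]
    rw [Real.exp_neg, mul_inv_le_iff₀ (Real.exp_pos _)]
    linarith
  have hterm : ∑ χ ∈ F, gibbs w χ * (w₀ - ∑ i ∈ χ, w i - L) ≤ 0 := by
    calc ∑ χ ∈ F, gibbs w χ * (w₀ - ∑ i ∈ χ, w i - L)
        ≤ ∑ χ ∈ F, (Real.exp (w₀ - L) - gibbs w χ) := by
          refine Finset.sum_le_sum fun χ _ => ?_
          have h1 := Real.add_one_le_exp (w₀ - ∑ i ∈ χ, w i - L)
          have h2 : Real.exp (w₀ - L) = gibbs w χ * Real.exp (w₀ - ∑ i ∈ χ, w i - L) := by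
            rw [gibbs, ← Real.exp_add]; congr 1; ring
          rw [h2]
          have h3 : 0 < gibbs w χ := Real.exp_pos _
          nlinarith
      _ = Real.exp w₀ * (F.card * Real.exp (-L)) - ∑ χ ∈ F, gibbs w χ := by
          rw [Finset.sum_sub_distrib, Finset.sum_const, nsmul_eq_mul, sub_eq_add_neg w₀,
            Real.exp_add]
          ring
      _ ≤ Real.exp w₀ * 1 - gibbs w χ₀ := by
          gcongr
          exact Finset.single_le_sum (f := gibbs w) (fun χ _ => (Real.exp_pos _).le)
            (hF.2 hχ₀)
      _ = 0 := by simp [gibbs, w₀]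
  have h1 : ∑ χ, π χ * (w₀ - ∑ i ∈ χ, w i - L) ≤ 0 := by
    rw [hsub]
    exact mul_nonpos_of_nonneg_of_nonpos (hnn ∅) hterm
  have h2 : ∑ χ, π χ * (w₀ - ∑ i ∈ χ, w i - L) = w₀ - ∑ χ, π χ * ∑ i ∈ χ, w i - L := by
    simp_rw [mul_sub]
    rw [Finset.sum_sub_distrib, Finset.sum_sub_distrib, ← Finset.sum_mul, ← Finset.sum_mul, hsum]
    ring
  linarith

end Network

/-! ### Queue bounds and the drift of one run -/

namespace Policy

variable {Ω M E : Type*}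

theorem mu_nonneg (p : Policy Ω M E) (t : ℕ) (ω : Ω) (m : M) (i : E) : 0 ≤ p.mu t ω m i := by
  unfold mu; split_ifs <;> norm_num

theorem mu_le_one (p : Policy Ω M E) (t : ℕ) (ω : Ω) (m : M) (i : E) : p.mu t ω m i ≤ 1 := by
  unfold mu; split_ifs <;> norm_num

end Policy

namespace Network

variable {Ω M E : Type*}

theorem one_le_size (N : Network M E) (m : M) : (1 : ℝ) ≤ N.size m := by
  exact_mod_cast N.size_pos m

theorem Amax_nonneg (N : Network M E) (m : M) (i : E) : 0 ≤ N.Amax m i := by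
  rcases N.Amax_jobs m i with h | h <;> linarith

theorem dmax_nonneg (N : Network M E) (m : M) (i : E) : 0 ≤ N.dmax m i :=
  (N.Amax_nonneg m i).trans (N.Amax_le_dmax m i)

theorem eps_le (N : Network M E) (m : M) (i : E) : N.eps m i ≤ N.dmax m i * N.size m := by
  have h := N.eps_le_dmax m i
  have hs := N.one_le_size m
  rwa [div_le_iff₀ (by linarith)] at h

theorem Amax_mul_le (N : Network M E) (m : M) (i : E) :
    N.Amax m i * N.size m ≤ N.dmax m i * N.size m := by
  have hs := N.one_le_size m
  have := N.Amax_le_dmax m i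
  gcongr

theorem Amax_mul_nonneg (N : Network M E) (m : M) (i : E) : 0 ≤ N.Amax m i * N.size m :=
  mul_nonneg (N.Amax_nonneg m i) (Nat.cast_nonneg _)

/-- The numbers of admitted and dropped jobs respect their upper bounds. -/
structure IsBounded (N : Network M E) (p : Policy Ω M E) : Prop where
  admission : ∀ t ω m i, p.r t ω m i ∈ Icc 0 (N.Amax m i)
  drop : ∀ t ω m i, p.d t ω m i ∈ Icc 0 (N.dmax m i)

section

variable {N : Network M E} {p : Policy Ω M E}

theorem IsBounded.r_mul_mem (h : N.IsBounded p) (t : ℕ) (ω : Ω) (m : M) (i : E) :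
    p.r t ω m i * N.size m ∈ Icc 0 (N.Amax m i * N.size m) := by
  have hs := N.one_le_size m
  obtain ⟨h1, h2⟩ := h.admission t ω m i
  exact ⟨by positivity, by gcongr⟩

theorem IsBounded.d_mul_mem (h : N.IsBounded p) (t : ℕ) (ω : Ω) (m : M) (i : E) :
    p.d t ω m i * N.size m ∈ Icc 0 (N.dmax m i * N.size m) := by
  have hs := N.one_le_size m
  obtain ⟨h1, h2⟩ := h.drop t ω m i
  exact ⟨by positivity, by gcongr⟩

theorem queueQ_succ (N : Network M E) (c : ℝ) (p : Policy Ω M E) (t : ℕ) (ω : Ω) (m : M) (i : E) :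
    N.queueQ c p (t + 1) ω m i =
      max (N.queueQ c p t ω m i - c * p.mu t ω m i - p.d t ω m i * N.size m) 0
        + p.r t ω m i * N.size m := rfl

theorem queueY_succ (N : Network M E) (p : Policy Ω M E) (η : ℕ → Ω → M → E → ℝ) (t : ℕ) (ω : Ω)
    (m : M) (i : E) :
    N.queueY p η (t + 1) ω m i =
      max (N.queueY p η t ω m i - p.r t ω m i * N.size m) 0 + η t ω m i * N.size m := rfl

open Classical in
theorem queueZ_succ (N : Network M E) (p : Policy Ω M E) (t : ℕ) (ω : Ω) (m : M) (i : E) :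
    N.queueZ p (t + 1) ω m i =
      max (N.queueZ p t ω m i
        + (if 0 < N.queueQ 1 p t ω m i then N.eps m i - p.mu t ω m i else 0)
        - p.d t ω m i * N.size m
        - (if N.queueQ 1 p t ω m i = 0 then 1 else 0)) 0 := rfl

theorem IsBounded.queueQ_nonneg (h : N.IsBounded p) (c : ℝ) (t : ℕ) (ω : Ω) (m : M) (i : E) :
    0 ≤ N.queueQ c p t ω m i := by
  cases t with
  | zero => exact le_rfl
  | succ t =>
    rw [queueQ_succ]
    exact add_nonneg (le_max_right _ _) (h.r_mul_mem t ω m i).1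

theorem queueZ_nonneg (N : Network M E) (p : Policy Ω M E) (t : ℕ) (ω : Ω) (m : M) (i : E) :
    0 ≤ N.queueZ p t ω m i := by
  cases t with
  | zero => exact le_rfl
  | succ t => exact le_max_right _ _

theorem IsBounded.weight_nonneg (h : N.IsBounded p) (t : ℕ) (ω : Ω) (m : M) (i : E) :
    0 ≤ N.weight p t ω m i :=
  add_nonneg (h.queueQ_nonneg _ _ _ _ _) (N.queueZ_nonneg _ _ _ _ _)

theorem IsBounded.linkWeight_nonneg [Fintype M] [Nonempty M] (h : N.IsBounded p) (t : ℕ) (ω : Ω)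
    (i : E) : 0 ≤ N.linkWeight p t ω i := by
  obtain ⟨m⟩ := ‹Nonempty M›
  exact (h.weight_nonneg t ω m i).trans
    (Finset.le_sup' (fun m => N.weight p t ω m i) (Finset.mem_univ m))

theorem IsBounded.queueQ_succ_le (h : N.IsBounded p) {c : ℝ} (hc : 0 ≤ c) (t : ℕ) (ω : Ω) (m : M)
    (i : E) :
    N.queueQ c p (t + 1) ω m i ≤ N.queueQ c p t ω m i + N.Amax m i * N.size m := by
  rw [queueQ_succ]
  have h1 := mul_nonneg hc (p.mu_nonneg t ω m i)
  have h2 := (h.d_mul_mem t ω m i).1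
  have h3 := h.queueQ_nonneg c t ω m i
  exact add_le_add (max_le (by linarith) h3) (h.r_mul_mem t ω m i).2

theorem IsBounded.queueQ_le (h : N.IsBounded p) {c : ℝ} (hc : 0 ≤ c) (t : ℕ) (ω : Ω) (m : M)
    (i : E) : N.queueQ c p t ω m i ≤ t * (N.Amax m i * N.size m) := by
  induction t with
  | zero => simp [queueQ]
  | succ t ih =>
    have := h.queueQ_succ_le hc t ω m i
    push_cast
    linarith

theorem IsBounded.queueZ_succ_le (h : N.IsBounded p) (t : ℕ) (ω : Ω) (m : M) (i : E) :
    N.queueZ p (t + 1) ω m i ≤ N.queueZ p t ω m i + N.eps m i := by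
  rw [queueZ_succ]
  have h1 := p.mu_nonneg t ω m i
  have h2 := (h.d_mul_mem t ω m i).1
  have h3 := N.queueZ_nonneg p t ω m i
  have h4 := N.eps_pos m i
  refine max_le ?_ (by linarith)
  split_ifs <;> linarith

theorem IsBounded.queueZ_le (h : N.IsBounded p) (t : ℕ) (ω : Ω) (m : M) (i : E) :
    N.queueZ p t ω m i ≤ t * N.eps m i := by
  induction t with
  | zero => simp [queueZ]
  | succ t ih =>
    have := h.queueZ_succ_le t ω m i
    push_cast
    linarith

theorem IsBounded.weight_add_le (h : N.IsBounded p) (t j : ℕ) (ω : Ω) (m : M) (i : E) :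
    N.weight p (t + j) ω m i ≤
      N.weight p t ω m i + j * (N.Amax m i * N.size m + N.eps m i) := by
  induction j with
  | zero => simp
  | succ j ih =>
    have h1 := h.queueZ_succ_le (t + j) ω m i
    have h2 := h.queueQ_succ_le zero_le_one (t + j) ω m i
    unfold weight at *
    rw [← add_assoc]
    push_cast
    linarith

theorem IsBounded.le_weight_succ (h : N.IsBounded p) (t : ℕ) (ω : Ω) (m : M) (i : E) :
    N.weight p t ω m i ≤
      N.weight p (t + 1) ω m i + (2 * N.dmax m i * N.size m + 2) := by
  unfold weight
  rw [queueQ_succ, queueZ_succ]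
  have h0 := h.queueQ_nonneg 1 t ω m i
  have h1 := p.mu_le_one t ω m i
  have h2 := (h.d_mul_mem t ω m i).2
  have h3 := (h.r_mul_mem t ω m i).1
  have h4 := N.eps_pos m i
  have h5 := le_max_left (N.queueQ 1 p t ω m i - 1 * p.mu t ω m i - p.d t ω m i * N.size m) 0
  have h6 := le_max_left (N.queueZ p t ω m i
        + (if 0 < N.queueQ 1 p t ω m i then N.eps m i - p.mu t ω m i else 0)
        - p.d t ω m i * N.size m
        - (if N.queueQ 1 p t ω m i = 0 then 1 else 0)) 0
  have h7 : -1 ≤ (if 0 < N.queueQ 1 p t ω m i then N.eps m i - p.mu t ω m i else 0)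
      - (if N.queueQ 1 p t ω m i = 0 then 1 else 0) := by
    split_ifs <;> linarith
  linarith

theorem IsBounded.le_weight_add (h : N.IsBounded p) (t j : ℕ) (ω : Ω) (m : M) (i : E) :
    N.weight p t ω m i ≤
      N.weight p (t + j) ω m i + j * (2 * N.dmax m i * N.size m + 2) := by
  induction j with
  | zero => simp
  | succ j ih =>
    have h1 := h.le_weight_succ (t + j) ω m i
    rw [← add_assoc]
    push_cast
    linarith

/-- The quadratic bound for a queue update.  The two increments have opposite signs, so that only
the larger of their squares is needed.  This improves on the sum of the squares, and the gain pays
for the entropy of the random schedule. -/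
theorem max_sub_add_sq_le {q α b K : ℝ} (hq : 0 ≤ q) (hα : 0 ≤ α) (hαK : α ≤ K) (hb : 0 ≤ b)
    (hbK : b ≤ K) : (max (q - b) 0 + α) ^ 2 ≤ q ^ 2 + 2 * (q * (α - b)) + K ^ 2 := by
  rcases le_total b q with h | h
  · rw [max_eq_left (by linarith)]
    nlinarith [sq_le_sq' (show -K ≤ α - b by linarith) (show α - b ≤ K by linarith)]
  · rw [max_eq_right (by linarith), zero_add]
    have h1 : (α - q) ^ 2 ≤ (K - q) ^ 2 + q ^ 2 := by
      rcases le_total q α with h2 | h2 <;> nlinarith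
    nlinarith

theorem IsBounded.queueQ_sq_le (h : N.IsBounded p) (t : ℕ) (ω : Ω) (m : M) (i : E) :
    N.queueQ 1 p (t + 1) ω m i ^ 2 ≤ N.queueQ 1 p t ω m i ^ 2
      + 2 * (N.queueQ 1 p t ω m i *
        (p.r t ω m i * N.size m - p.mu t ω m i - p.d t ω m i * N.size m))
      + (1 + N.dmax m i * N.size m) ^ 2 := by
  obtain ⟨h1, h2⟩ := h.r_mul_mem t ω m i
  obtain ⟨h3, h4⟩ := h.d_mul_mem t ω m i
  have h5 := p.mu_nonneg t ω m i
  have h6 := p.mu_le_one t ω m i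
  have h7 := N.Amax_mul_le m i
  have := max_sub_add_sq_le (h.queueQ_nonneg 1 t ω m i) h1
    (show _ ≤ 1 + N.dmax m i * N.size m by linarith) (add_nonneg h5 h3) (by linarith)
  rw [queueQ_succ, one_mul, sub_sub]
  simpa only [sub_sub] using this

theorem IsBounded.queueZ_sq_le (h : N.IsBounded p) (t : ℕ) (ω : Ω) (m : M) (i : E) :
    N.queueZ p (t + 1) ω m i ^ 2 ≤ N.queueZ p t ω m i ^ 2
      + 2 * (N.queueZ p t ω m i * (N.eps m i - p.mu t ω m i - p.d t ω m i * N.size m))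
      + ((1 + N.dmax m i * N.size m) ^ 2 + N.eps m i ^ 2) := by
  obtain ⟨h3, h4⟩ := h.d_mul_mem t ω m i
  have h5 := p.mu_nonneg t ω m i
  have h6 := p.mu_le_one t ω m i
  have h7 := N.eps_pos m i
  have h8 := N.queueZ_nonneg p t ω m i
  have hmax : ∀ y : ℝ, max y 0 ^ 2 ≤ y ^ 2 := fun y => by
    rcases le_total 0 y with hy | hy
    · rw [max_eq_left hy]
    · rw [max_eq_right hy]; nlinarith
  rw [queueZ_succ]
  refine (hmax _).trans ?_
  rcases (h.queueQ_nonneg 1 t ω m i).eq_or_lt with h0 | h0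
  · rw [← h0, if_neg (lt_irrefl _), if_pos rfl]
    have h9 : (1 + p.d t ω m i * N.size m) ^ 2 ≤ (1 + N.dmax m i * N.size m) ^ 2 := by gcongr
    nlinarith [mul_nonneg h8 (show 0 ≤ 1 + N.eps m i - p.mu t ω m i by linarith)]
  · rw [if_pos h0, if_neg h0.ne']
    have h9 : (p.mu t ω m i + p.d t ω m i * N.size m) ^ 2 ≤ (1 + N.dmax m i * N.size m) ^ 2 := by
      gcongr
    nlinarith [mul_nonneg h7.le (add_nonneg h5 h3)]

end

theorem derivWithin_U_nonneg (N : Network M E) : 0 ≤ derivWithin N.U (Ici 0) 0 :=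
  N.U_mono.derivWithin_nonneg

/-- By concavity, the utility grows at most with slope `U'(0)`. -/
theorem U_add_le (N : Network M E) {x h : ℝ} (hx : 0 ≤ x) (hh : 0 ≤ h) :
    N.U (x + h) ≤ N.U x + derivWithin N.U (Ici 0) 0 * h := by
  rcases hh.eq_or_lt with rfl | hh
  · simp
  have h1 := N.U_concave.slope_le_derivWithin (x := x) (y := x + h) hx
    (show 0 ≤ x + h by linarith) (by linarith) (N.U_diff x hx)
  have h2 := N.U_concave.antitoneOn_derivWithin N.U_diff self_mem_Ici hx hx
  rw [slope_def_field, add_sub_cancel_left, div_le_iff₀ hh] at h1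
  nlinarith

section Run

variable [Fintype M] [Nonempty M] [Fintype E] [mΩ : MeasurableSpace Ω] {N : Network M E}
  {P : Measure Ω} {A : ℕ → Ω → M → E → ℝ} {W : ℕ} {V : ℝ} {T : ℕ} {ℱ : Filtration ℕ mΩ}
  {p : Policy Ω M E} {η : ℕ → Ω → M → E → ℝ}

theorem IsRun.isBounded (h : N.IsRun P A W V T ℱ p η) (hA : N.IsArrivals P A) :
    N.IsBounded p where
  admission t ω m i := by
    rw [h.admission]
    split_ifs
    · exact ⟨hA.nonneg t ω m i, hA.le_max t ω m i⟩
    · exact ⟨le_rfl, N.Amax_nonneg m i⟩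
  drop t ω m i := by
    rw [h.drop]
    split_ifs
    · exact ⟨N.dmax_nonneg m i, le_rfl⟩
    · exact ⟨le_rfl, N.dmax_nonneg m i⟩

theorem IsRun.aux_mul_mem (h : N.IsRun P A W V T ℱ p η) (t : ℕ) (ω : Ω) (m : M) (i : E) :
    η t ω m i * N.size m ∈ Icc 0 (N.Amax m i * N.size m) := by
  have hs := N.one_le_size m
  obtain ⟨h1, h2⟩ := h.aux_mem t ω m i
  exact ⟨by positivity, by gcongr⟩

theorem IsRun.queueY_nonneg (h : N.IsRun P A W V T ℱ p η) (t : ℕ) (ω : Ω) (m : M) (i : E) :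
    0 ≤ N.queueY p η t ω m i := by
  cases t with
  | zero => exact le_rfl
  | succ t => exact add_nonneg (le_max_right _ _) (h.aux_mul_mem t ω m i).1

/-- The auxiliary variable vanishes as soon as `Y` exceeds `V U'(0)`. -/
theorem IsRun.queueY_le (h : N.IsRun P A W V T ℱ p η) (hA : N.IsArrivals P A) (hV : 0 < V)
    (t : ℕ) (ω : Ω) (m : M) (i : E) :
    N.queueY p η t ω m i ≤ V * derivWithin N.U (Ici 0) 0 + N.Amax m i * N.size m := by
  have hd := N.derivWithin_U_nonneg
  induction t with
  | zero => exact add_nonneg (mul_nonneg hV.le hd) (N.Amax_mul_nonneg m i)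
  | succ t ih =>
    rw [queueY_succ]
    obtain ⟨h1, h2⟩ := h.aux_mul_mem t ω m i
    have h3 := ((h.isBounded hA).r_mul_mem t ω m i).1
    have h4 := h.queueY_nonneg t ω m i
    have h5 := h.aux_max t ω m i 0 ⟨le_rfl, N.Amax_nonneg m i⟩
    have h6 := mul_le_mul_of_nonneg_left (N.U_add_le le_rfl h1) hV.le
    rw [zero_add] at h6
    have hmax : max (N.queueY p η t ω m i - p.r t ω m i * N.size m) 0 ≤ N.queueY p η t ω m i :=
      max_le (by linarith) h4
    rcases le_or_gt (N.queueY p η t ω m i) (V * derivWithin N.U (Ici 0) 0) with h7 | h7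
    · linarith
    · have h8 : η t ω m i * N.size m = 0 := by
        by_contra hne
        have hpos := lt_of_le_of_ne h1 (Ne.symm hne)
        simp only [zero_mul, mul_zero, sub_zero] at h5
        nlinarith
      linarith

/-- The constant of the pair `(m, i)` in the drift bound, whose sum is `N.B`. -/
noncomputable def pairB (N : Network M E) (m : M) (i : E) : ℝ :=
  1 / 2 * (3 * (N.Amax m i * N.size m) ^ 2 + 2 * (1 + N.dmax m i * N.size m) ^ 2
    + N.eps m i ^ 2)

theorem IsRun.queues_eq_zero (h : N.IsRun P A W V T ℱ p η) (hA : N.IsArrivals P A) {m : M}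
    {i : E} (h0 : N.Amax m i = 0) (t : ℕ) (ω : Ω) :
    N.queueQ 1 p t ω m i = 0 ∧ N.queueY p η t ω m i = 0 ∧ N.queueZ p t ω m i = 0 := by
  induction t with
  | zero => exact ⟨rfl, rfl, rfl⟩
  | succ t ih =>
    obtain ⟨h1, h2, h3⟩ := ih
    have hr : p.r t ω m i = 0 :=
      le_antisymm (h0 ▸ ((h.isBounded hA).admission t ω m i).2)
        ((h.isBounded hA).admission t ω m i).1
    have hη : η t ω m i = 0 :=
      le_antisymm (h0 ▸ (h.aux_mem t ω m i).2) (h.aux_mem t ω m i).1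
    have h4 := ((h.isBounded hA).d_mul_mem t ω m i).1
    have h5 := p.mu_nonneg t ω m i
    rw [queueQ_succ, queueY_succ, queueZ_succ, h1, h2, h3, hr, hη]
    refine ⟨?_, by simp, ?_⟩
    · rw [max_eq_right (by linarith)]; simp
    · rw [if_neg (lt_irrefl _), if_pos rfl, max_eq_right (by linarith)]

/-- The drift of one pair `(m, i)`.  The second-order terms stay below the constant of the drift
bound by one. -/
theorem IsRun.pair_drift (h : N.IsRun P A W V T ℱ p η) (hA : N.IsArrivals P A) (t : ℕ) (ω : Ω)
    (m : M) (i : E) :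
    1 / 2 * (N.queueQ 1 p (t + 1) ω m i ^ 2 + N.queueY p η (t + 1) ω m i ^ 2
        + N.queueZ p (t + 1) ω m i ^ 2) ≤
      1 / 2 * (N.queueQ 1 p t ω m i ^ 2 + N.queueY p η t ω m i ^ 2 + N.queueZ p t ω m i ^ 2)
      + (N.queueQ 1 p t ω m i * (p.r t ω m i * N.size m - p.mu t ω m i - p.d t ω m i * N.size m)
      + N.queueY p η t ω m i * (η t ω m i * N.size m - p.r t ω m i * N.size m)
      + N.queueZ p t ω m i * (N.eps m i - p.mu t ω m i - p.d t ω m i * N.size m))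
      + (N.pairB m i - 1) := by
  have hs := N.one_le_size m
  rcases N.Amax_jobs m i with h0 | h1
  · obtain ⟨h1, h2, h3⟩ := h.queues_eq_zero hA h0 t ω
    obtain ⟨h4, h5, h6⟩ := h.queues_eq_zero hA h0 (t + 1) ω
    rw [h1, h2, h3, h4, h5, h6, pairB, h0]
    have := mul_nonneg (N.dmax_nonneg m i) (Nat.cast_nonneg (α := ℝ) (N.size m))
    nlinarith [sq_nonneg (N.eps m i)]
  · have hb := h.isBounded hA
    have hQ := hb.queueQ_sq_le t ω m i
    have hZ := hb.queueZ_sq_le t ω m i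
    have hY := max_sub_add_sq_le (h.queueY_nonneg t ω m i) (h.aux_mul_mem t ω m i).1
      (h.aux_mul_mem t ω m i).2 (hb.r_mul_mem t ω m i).1 (hb.r_mul_mem t ω m i).2
    rw [← queueY_succ] at hY
    have ha : 1 ≤ (N.Amax m i * N.size m) ^ 2 := one_le_pow₀ (by nlinarith)
    unfold pairB
    linarith

/-- The quadratic Lyapunov function of all queues. -/
noncomputable def lyapunov (N : Network M E) (p : Policy Ω M E) (η : ℕ → Ω → M → E → ℝ) (t : ℕ)
    (ω : Ω) : ℝ :=
  ∑ m, ∑ i, 1 / 2 * (N.queueQ 1 p t ω m i ^ 2 + N.queueY p η t ω m i ^ 2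
    + N.queueZ p t ω m i ^ 2)

theorem sum_pairB_sub_one_le (N : Network M E) :
    ∑ m, ∑ i, (N.pairB m i - 1) ≤ N.B - Fintype.card E := by
  have h1 : (1 : ℝ) ≤ Fintype.card M := by exact_mod_cast Fintype.card_pos
  simp only [Finset.sum_sub_distrib, Finset.sum_const, Finset.card_univ, nsmul_eq_mul, mul_one]
  have h2 : N.B = ∑ m, ∑ i, N.pairB m i := by
    simp only [B, pairB, Finset.mul_sum]
  rw [h2]
  have : (Fintype.card E : ℝ) ≤ Fintype.card M * Fintype.card E :=
    le_mul_of_one_le_left (Nat.cast_nonneg _) h1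
  linarith

/-- In the slots of a super slot in which all job types can still be started, a scheduled link
serves a type whose weight is close to the weight of the link at the start of the super slot. -/
theorem IsRun.exists_serve (h : N.IsRun P A W V T ℱ p η) (hA : N.IsArrivals P A)
    (n : ℕ) {j : ℕ} (hj : j + N.maxSize ≤ T) (ω : Ω) {i : E} (hi : i ∈ p.x (n * T) ω) :
    ∃ m, p.serve (n * T + j) ω i = some m ∧ ∀ m', N.weight p (n * T) ω m' i ≤
      N.weight p (n * T + j) ω m i + j * ∑ m, (2 * N.dmax m i * N.size m + 2) := by
  have hb := h.isBounded hA
  have hsize : ∀ m, N.size m ≤ N.maxSize := fun m => Finset.le_sup (Finset.mem_univ m)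
  have hpos : 0 < N.maxSize := by
    obtain ⟨m⟩ := ‹Nonempty M›
    exact (N.size_pos m).trans (hsize m)
  set K := ∑ m, (2 * N.dmax m i * N.size m + 2)
  have hterm : ∀ m, 0 ≤ 2 * N.dmax m i * N.size m + 2 := fun m => by
    have := N.dmax_nonneg m i
    positivity
  have hK : ∀ m, 2 * N.dmax m i * N.size m + 2 ≤ K := fun m =>
    Finset.single_le_sum (f := fun m => 2 * N.dmax m i * N.size m + 2) (fun m _ => hterm m)
      (Finset.mem_univ m)
  have hdiv : ∀ j, j + N.maxSize ≤ T → (n * T + j) / T = n := fun j hj => by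
    rw [mul_comm, Nat.mul_add_div (by omega), Nat.div_eq_of_lt (by omega), add_zero]
  have hx : ∀ j, j + N.maxSize ≤ T → i ∈ p.x (n * T + j) ω := fun j hj => by
    rw [h.schedule_fixed, hdiv j hj]; exact hi
  have hfits : ∀ j, j + N.maxSize ≤ T → ∀ m, N.Fits T (n * T + j) m := fun j hj m => by
    have := hsize m
    rw [Fits, hdiv j hj, add_mul]
    omega
  -- a job that is started now has the maximum weight
  have hnew : ∀ j, j + N.maxSize ≤ T → N.left T p (n * T + j) ω i = 0 →
      ∃ m, p.serve (n * T + j) ω i = some m ∧ ∀ m', N.weight p (n * T) ω m' i ≤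
        N.weight p (n * T + j) ω m i + j * K := by
    intro j hj hl
    cases hs : p.serve (n * T + j) ω i with
    | none =>
      obtain ⟨m⟩ := ‹Nonempty M›
      exact absurd (hfits j hj m) (h.serve_none _ ω i (hx j hj) hl hs m)
    | some m =>
      refine ⟨m, rfl, fun m' => ?_⟩
      have h1 := (h.serve_max _ ω i (hx j hj) hl m hs).2 m' (hfits j hj m')
      have h2 := hb.le_weight_add (n * T) j ω m' i
      have h3 := mul_le_mul_of_nonneg_left (hK m') (Nat.cast_nonneg (α := ℝ) j)
      linarith
  induction j with
  | zero =>
    refine hnew 0 hj ?_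
    rcases Nat.eq_zero_or_pos (n * T) with h0 | h0
    · rw [add_zero, h0]; rfl
    · obtain ⟨k, hk⟩ := Nat.exists_eq_succ_of_ne_zero h0.ne'
      have : T ∣ k + 1 := ⟨n, by rw [mul_comm]; exact hk.symm⟩
      rw [add_zero, hk, Nat.succ_eq_add_one]
      exact if_pos this
  | succ j ih =>
    rcases Nat.eq_zero_or_pos (N.left T p (n * T + (j + 1)) ω i) with hl | hl
    · exact hnew _ hj hl
    · obtain ⟨m, hm, hw⟩ := ih (by omega)
      refine ⟨m, ?_, fun m' => ?_⟩
      · rw [h.serve_continue _ ω i (hx _ hj) hl]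
        exact hm
      · have h1 := hw m'
        have h2 := hb.le_weight_succ (n * T + j) ω m i
        have h3 := hK m
        rw [← add_assoc]
        push_cast
        linarith

/-- The weight served in a slot in which all job types can still be started. -/
theorem IsRun.served_weight_ge (h : N.IsRun P A W V T ℱ p η) (hA : N.IsArrivals P A)
    (n : ℕ) {j : ℕ} (hj : j + N.maxSize ≤ T) (ω : Ω) :
    ∑ i ∈ p.x (n * T) ω, N.linkWeight p (n * T) ω i - j * N.B' ≤
      ∑ m, ∑ i, N.weight p (n * T + j) ω m i * p.mu (n * T + j) ω m i := by
  have hb := h.isBounded hA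
  have hB : ∀ i, 0 ≤ ∑ m, ((N.Amax m i + 2 * N.dmax m i) * N.size m + 2) := fun i =>
    Finset.sum_nonneg fun m _ => by
      have := N.dmax_nonneg m i
      have := N.Amax_nonneg m i
      positivity
  have hnn : ∀ m i, 0 ≤ N.weight p (n * T + j) ω m i * p.mu (n * T + j) ω m i := fun m i =>
    mul_nonneg (hb.weight_nonneg _ _ _ _) (p.mu_nonneg _ _ _ _)
  have hlink : ∀ i ∈ p.x (n * T) ω, N.linkWeight p (n * T) ω i
      - j * ∑ m, ((N.Amax m i + 2 * N.dmax m i) * N.size m + 2) ≤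
      ∑ m, N.weight p (n * T + j) ω m i * p.mu (n * T + j) ω m i := by
    intro i hi
    obtain ⟨m, hm, hw⟩ := h.exists_serve hA n hj ω hi
    have h1 : N.linkWeight p (n * T) ω i ≤ N.weight p (n * T + j) ω m i
        + j * ∑ m, (2 * N.dmax m i * N.size m + 2) :=
      Finset.sup'_le _ _ fun m' _ => hw m'
    have h2 : ∑ m, (2 * N.dmax m i * N.size m + 2) ≤
        ∑ m, ((N.Amax m i + 2 * N.dmax m i) * N.size m + 2) :=
      Finset.sum_le_sum fun m _ => by nlinarith [N.Amax_mul_nonneg m i]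
    have h3 := mul_le_mul_of_nonneg_left h2 (Nat.cast_nonneg (α := ℝ) j)
    have h4 := Finset.single_le_sum (fun m _ => hnn m i) (Finset.mem_univ m)
    have h5 : p.mu (n * T + j) ω m i = 1 := by simp [Policy.mu, hm]
    rw [h5, mul_one] at h4
    linarith
  calc ∑ i ∈ p.x (n * T) ω, N.linkWeight p (n * T) ω i - j * N.B'
      ≤ ∑ i ∈ p.x (n * T) ω, N.linkWeight p (n * T) ω i
        - j * ∑ i ∈ p.x (n * T) ω, ∑ m, ((N.Amax m i + 2 * N.dmax m i) * N.size m + 2) := by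
        unfold B'
        gcongr
        exacts [fun i _ _ => hB i, Finset.subset_univ _]
    _ = ∑ i ∈ p.x (n * T) ω, (N.linkWeight p (n * T) ω i
        - j * ∑ m, ((N.Amax m i + 2 * N.dmax m i) * N.size m + 2)) := by
        rw [Finset.sum_sub_distrib, Finset.mul_sum]
    _ ≤ ∑ i ∈ p.x (n * T) ω, ∑ m, N.weight p (n * T + j) ω m i * p.mu (n * T + j) ω m i :=
        Finset.sum_le_sum hlink
    _ ≤ ∑ i, ∑ m, N.weight p (n * T + j) ω m i * p.mu (n * T + j) ω m i :=
        Finset.sum_le_univ_sum_of_nonneg fun i => Finset.sum_nonneg fun m _ => hnn m i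
    _ = _ := Finset.sum_comm

end Run

end Network

/-! ### Expected drift in one slot -/

/-- Bounded measurable functions: a class that is closed under the ring operations and consists of
integrable functions. -/
structure BoundedMeasurable {Ω : Type*} [MeasurableSpace Ω] (f : Ω → ℝ) : Prop where
  measurable : Measurable f
  bounded : ∃ C, ∀ ω, |f ω| ≤ C

namespace BoundedMeasurable

variable {Ω : Type*} [MeasurableSpace Ω] {f g : Ω → ℝ}

theorem of_mem_Icc (hf : Measurable f) {a b : ℝ} (h : ∀ ω, f ω ∈ Icc a b) :
    BoundedMeasurable f :=
  ⟨hf, max |a| |b|, fun ω => abs_le_max_abs_abs (h ω).1 (h ω).2⟩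

theorem const (c : ℝ) : BoundedMeasurable fun _ : Ω => c := ⟨measurable_const, |c|, fun _ => le_rfl⟩

theorem add (hf : BoundedMeasurable f) (hg : BoundedMeasurable g) :
    BoundedMeasurable fun ω => f ω + g ω := by
  obtain ⟨C, hC⟩ := hf.bounded
  obtain ⟨D, hD⟩ := hg.bounded
  exact ⟨hf.measurable.add hg.measurable, C + D, fun ω =>
    (abs_add_le _ _).trans (add_le_add (hC ω) (hD ω))⟩

theorem mul (hf : BoundedMeasurable f) (hg : BoundedMeasurable g) :
    BoundedMeasurable fun ω => f ω * g ω := by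
  obtain ⟨C, hC⟩ := hf.bounded
  obtain ⟨D, hD⟩ := hg.bounded
  refine ⟨hf.measurable.mul hg.measurable, C * D, fun ω => ?_⟩
  rw [abs_mul]
  exact mul_le_mul (hC ω) (hD ω) (abs_nonneg _) ((abs_nonneg _).trans (hC ω))

theorem sub (hf : BoundedMeasurable f) (hg : BoundedMeasurable g) :
    BoundedMeasurable fun ω => f ω - g ω := by
  simpa [sub_eq_add_neg] using hf.add ((const (-1)).mul hg)

theorem sq (hf : BoundedMeasurable f) : BoundedMeasurable fun ω => f ω ^ 2 := by
  simpa only [_root_.sq] using hf.mul hf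

theorem sum {ι : Type*} (s : Finset ι) {f : ι → Ω → ℝ} (hf : ∀ i ∈ s, BoundedMeasurable (f i)) :
    BoundedMeasurable fun ω => ∑ i ∈ s, f i ω := by
  classical
  induction s using Finset.induction_on with
  | empty => simpa using const 0
  | insert i s hi ih =>
    simp only [Finset.sum_insert hi]
    exact (hf i (Finset.mem_insert_self i s)).add
      (ih fun j hj => hf j (Finset.mem_insert_of_mem hj))

theorem sum₂ {M E : Type*} [Fintype M] [Fintype E] {f : M → E → Ω → ℝ}
    (hf : ∀ m i, BoundedMeasurable (f m i)) : BoundedMeasurable fun ω => ∑ m, ∑ i, f m i ω :=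
  sum _ fun m _ => sum _ fun i _ => hf m i

theorem integrable (hf : BoundedMeasurable f) (P : Measure Ω) [IsFiniteMeasure P] :
    Integrable f P := by
  obtain ⟨C, hC⟩ := hf.bounded
  exact Integrable.of_bound hf.measurable.aestronglyMeasurable C (ae_of_all _ hC)

theorem integral_sum₂ {M E : Type*} [Fintype M] [Fintype E] {f : M → E → Ω → ℝ}
    (hf : ∀ m i, BoundedMeasurable (f m i)) (P : Measure Ω) [IsFiniteMeasure P] :
    ∫ ω, ∑ m, ∑ i, f m i ω ∂P = ∑ m, ∑ i, ∫ ω, f m i ω ∂P := by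
  rw [integral_finsetSum _ fun m _ => (sum _ fun i _ => hf m i).integrable P]
  exact Finset.sum_congr rfl fun m _ => integral_finsetSum _ fun i _ => (hf m i).integrable P

end BoundedMeasurable

namespace Network

variable {Ω M E : Type*}

/-- The feasible long-term rates: admission rates `ρ`, drop rates `dl` and service rates `σ` that
keep the queues stable up to a slack `e` when the fraction `c` of the capacity is used; `a` are the
mean arrivals.  That `σ` lies below the convex hull of the collision-free schedules is expressed by
the support function of this hull, for non-negative link weights. -/
structure IsRatePoint [Fintype M] [Fintype E] (N : Network M E) (a : M → E → ℝ) (c e : ℝ)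
    (ρ dl σ : M → E → ℝ) : Prop where
  admission : ∀ m i, ρ m i ∈ Icc 0 (a m i)
  drop : ∀ m i, dl m i ∈ Icc 0 (N.dmax m i)
  service_nonneg : ∀ m i, 0 ≤ σ m i
  service_le : ∀ w : E → ℝ, (∀ i, 0 ≤ w i) → ∀ K, (∀ χ, N.Feasible χ → ∑ i ∈ χ, w i ≤ K) →
    ∑ m, ∑ i, w i * σ m i ≤ K
  rate : ∀ m i, ρ m i * N.size m ≤ c * σ m i + dl m i * N.size m + e
  delay : ∀ m i, N.eps m i ≤ c * σ m i + dl m i * N.size m + e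

/-- The net utility of long-term rates. -/
noncomputable def rateUtility [Fintype M] [Fintype E] (N : Network M E) (ρ dl : M → E → ℝ) : ℝ :=
  ∑ m, ∑ i, (N.U (ρ m i * N.size m) - N.β * dl m i * N.size m)

/-- The net utility of the auxiliary variables and the drops in slot `t`. -/
noncomputable def slotUtility [Fintype M] [Fintype E] (N : Network M E) (p : Policy Ω M E)
    (η : ℕ → Ω → M → E → ℝ) (t : ℕ) (ω : Ω) : ℝ :=
  N.rateUtility (η t ω) (p.d t ω)

/-- The mean number of arriving jobs per slot. -/
noncomputable def meanArrival [MeasurableSpace Ω] (P : Measure Ω) (A : ℕ → Ω → M → E → ℝ) (m : M)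
    (i : E) : ℝ :=
  ∫ ω, A 0 ω m i ∂P

section

variable [MeasurableSpace Ω] {N : Network M E} {P : Measure Ω} {A : ℕ → Ω → M → E → ℝ}

theorem IsArrivals.boundedMeasurable (hA : N.IsArrivals P A) (t : ℕ) (m : M) (i : E) :
    BoundedMeasurable fun ω => A t ω m i :=
  .of_mem_Icc (measurable_pi_iff.1 (measurable_pi_iff.1 (hA.measurable t) m) i)
    fun ω => ⟨hA.nonneg t ω m i, hA.le_max t ω m i⟩

theorem IsArrivals.integral_eq (hA : N.IsArrivals P A) (t : ℕ) (m : M) (i : E) :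
    ∫ ω, A t ω m i ∂P = meanArrival P A m i :=
  ((hA.ident t).comp (u := fun a : M → E → ℝ => a m i) (by fun_prop)).integral_eq

theorem IsArrivals.meanArrival_le [IsProbabilityMeasure P] (hA : N.IsArrivals P A) (m : M)
    (i : E) : meanArrival P A m i ≤ N.Amax m i := by
  have := integral_mono ((hA.boundedMeasurable 0 m i).integrable P)
    (integrable_const (N.Amax m i)) fun ω => hA.le_max 0 ω m i
  simpa [meanArrival] using this

end

theorem continuous_U_max (N : Network M E) : Continuous fun y => N.U (max y 0) :=
  N.U_diff.continuousOn.comp_continuous (by fun_prop) fun y => le_max_right y 0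

theorem U_nonneg_le (N : Network M E) {y b : ℝ} (hy : y ∈ Icc 0 b) : N.U y ∈ Icc 0 (N.U b) :=
  ⟨N.U_nonneg y hy.1, N.U_mono hy.1 (hy.1.trans hy.2) hy.2⟩

theorem boundedMeasurable_U (N : Network M E) [MeasurableSpace Ω] {f : Ω → ℝ} (hf : Measurable f)
    {b : ℝ} (h : ∀ ω, f ω ∈ Icc 0 b) : BoundedMeasurable fun ω => N.U (f ω) := by
  refine .of_mem_Icc ?_ fun ω => N.U_nonneg_le (h ω)
  have h1 : (fun ω => N.U (f ω)) = fun ω => N.U (max (f ω) 0) :=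
    funext fun ω => by rw [max_eq_left (h ω).1]
  rw [h1]
  exact N.continuous_U_max.measurable.comp hf

section Run

variable [Fintype M] [Nonempty M] [Fintype E] [mΩ : MeasurableSpace Ω] {N : Network M E}
  {P : Measure Ω} {A : ℕ → Ω → M → E → ℝ} {W : ℕ} {V : ℝ} {T : ℕ} {ℱ : Filtration ℕ mΩ}
  {p : Policy Ω M E} {η : ℕ → Ω → M → E → ℝ}

/-- The decisions of the algorithm on `η` and `d` do at least as well in the drift as the rates
`ρ` and `dl`.  What remains is the difference of the service terms, and an admission term that is
non-positive in expectation. -/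
theorem IsRun.pair_compare (h : N.IsRun P A W V T ℱ p η) (hA : N.IsArrivals P A)
    {a : M → E → ℝ} (ha : ∀ m i, a m i ≤ N.Amax m i) {c : ℝ}
    {ρ dl σ : M → E → ℝ} (hR : N.IsRatePoint a c 0 ρ dl σ) (t : ℕ) (ω : Ω) (m : M) (i : E) :
    N.queueQ 1 p t ω m i * (p.r t ω m i * N.size m - p.mu t ω m i - p.d t ω m i * N.size m)
      + N.queueY p η t ω m i * (η t ω m i * N.size m - p.r t ω m i * N.size m)
      + N.queueZ p t ω m i * (N.eps m i - p.mu t ω m i - p.d t ω m i * N.size m) ≤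
    V * (N.U (η t ω m i * N.size m) - N.β * p.d t ω m i * N.size m)
      - V * (N.U (ρ m i * N.size m) - N.β * dl m i * N.size m)
      + N.weight p t ω m i * (c * σ m i - p.mu t ω m i)
      + (N.queueQ 1 p t ω m i - N.queueY p η t ω m i) * (p.r t ω m i - ρ m i) * N.size m := by
  have hs := N.one_le_size m
  have h1 := h.aux_max t ω m i (ρ m i)
    ⟨(hR.admission m i).1, (hR.admission m i).2.trans (ha m i)⟩
  have h2 : (V * N.β - N.weight p t ω m i) * (p.d t ω m i * N.size m) ≤
      (V * N.β - N.weight p t ω m i) * (dl m i * N.size m) := by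
    rw [h.drop]
    obtain ⟨h3, h4⟩ := hR.drop m i
    have h5 : dl m i * N.size m ≤ N.dmax m i * N.size m := by gcongr
    have h6 : 0 ≤ dl m i * N.size m := by positivity
    unfold weight
    split_ifs with hc <;> nlinarith
  have h3 := mul_nonneg ((h.isBounded hA).queueQ_nonneg 1 t ω m i)
    (sub_nonneg.2 (hR.rate m i))
  have h4 := mul_nonneg (N.queueZ_nonneg p t ω m i) (sub_nonneg.2 (hR.delay m i))
  unfold weight at *
  linarith

theorem IsRun.lyapunov_succ_le (h : N.IsRun P A W V T ℱ p η) (hA : N.IsArrivals P A)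
    {a : M → E → ℝ} (ha : ∀ m i, a m i ≤ N.Amax m i) {c : ℝ}
    {ρ dl σ : M → E → ℝ} (hR : N.IsRatePoint a c 0 ρ dl σ) (t : ℕ) (ω : Ω) :
    N.lyapunov p η (t + 1) ω ≤ N.lyapunov p η t ω + V * N.slotUtility p η t ω
      + (N.B - Fintype.card E - V * N.rateUtility ρ dl)
      + ∑ m, ∑ i, N.weight p t ω m i * (c * σ m i - p.mu t ω m i)
      + ∑ m, ∑ i, (N.queueQ 1 p t ω m i - N.queueY p η t ω m i) * (p.r t ω m i - ρ m i)
          * N.size m := by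
  have h1 : N.lyapunov p η (t + 1) ω ≤ ∑ m, ∑ i,
      (1 / 2 * (N.queueQ 1 p t ω m i ^ 2 + N.queueY p η t ω m i ^ 2 + N.queueZ p t ω m i ^ 2)
      + V * (N.U (η t ω m i * N.size m) - N.β * p.d t ω m i * N.size m)
      - V * (N.U (ρ m i * N.size m) - N.β * dl m i * N.size m)
      + N.weight p t ω m i * (c * σ m i - p.mu t ω m i)
      + (N.queueQ 1 p t ω m i - N.queueY p η t ω m i) * (p.r t ω m i - ρ m i) * N.size m
      + (N.pairB m i - 1)) :=
    Finset.sum_le_sum fun m _ => Finset.sum_le_sum fun i _ => by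
      have h1 := h.pair_drift hA t ω m i
      have h2 := h.pair_compare hA ha hR t ω m i
      linarith
  have h2 := N.sum_pairB_sub_one_le
  unfold lyapunov at h1 ⊢
  unfold slotUtility rateUtility
  simp only [Finset.sum_add_distrib, Finset.sum_sub_distrib, ← Finset.mul_sum] at h1 h2 ⊢
  linarith

theorem IsRun.measurable_mu (h : N.IsRun P A W V T ℱ p η) (t : ℕ) (m : M) (i : E) :
    Measurable[ℱ (t + 1)] fun ω => p.mu t ω m i :=
  Measurable.ite (h.serve_adapted t i (some m)) measurable_const measurable_const

theorem IsRun.measurable_aux (h : N.IsRun P A W V T ℱ p η) (t : ℕ) (m : M) (i : E) :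
    Measurable[ℱ (t + 1)] fun ω => η t ω m i :=
  (measurable_pi_apply i).comp ((measurable_pi_apply m).comp (h.aux_adapted t))

theorem IsRun.measurable_r (h : N.IsRun P A W V T ℱ p η) {t : ℕ} {m : M} {i : E}
    (hQ : Measurable[ℱ t] fun ω => N.queueQ 1 p t ω m i)
    (hY : Measurable[ℱ t] fun ω => N.queueY p η t ω m i) :
    Measurable[ℱ (t + 1)] fun ω => p.r t ω m i := by
  have hmono := ℱ.mono (Nat.le_succ t)
  have h1 : Measurable[ℱ (t + 1)] fun ω => A t ω m i :=
    (measurable_pi_apply i).comp ((measurable_pi_apply m).comp (h.arrival_adapted t))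
  simp only [h.admission]
  exact Measurable.ite (measurableSet_lt measurable_const
    ((hY.mono hmono le_rfl).sub (hQ.mono hmono le_rfl))) h1 measurable_const

theorem IsRun.measurable_d (h : N.IsRun P A W V T ℱ p η) {t : ℕ} {m : M} {i : E}
    (hQ : Measurable[ℱ t] fun ω => N.queueQ 1 p t ω m i)
    (hZ : Measurable[ℱ t] fun ω => N.queueZ p t ω m i) :
    Measurable[ℱ t] fun ω => p.d t ω m i := by
  simp only [h.drop]
  exact Measurable.ite (measurableSet_lt measurable_const (hQ.add hZ)) measurable_const
    measurable_const

theorem IsRun.measurable_queues (h : N.IsRun P A W V T ℱ p η) (t : ℕ) (m : M) (i : E) :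
    Measurable[ℱ t] (fun ω => N.queueQ 1 p t ω m i) ∧
    Measurable[ℱ t] (fun ω => N.queueY p η t ω m i) ∧
    Measurable[ℱ t] (fun ω => N.queueZ p t ω m i) := by
  induction t with
  | zero => exact ⟨measurable_const, measurable_const, measurable_const⟩
  | succ t ih =>
    obtain ⟨hQ, hY, hZ⟩ := ih
    have hmono := ℱ.mono (Nat.le_succ t)
    have hr := (h.measurable_r hQ hY).mul_const (N.size m : ℝ)
    have hd := ((h.measurable_d hQ hZ).mono hmono le_rfl).mul_const (N.size m : ℝ)
    have hμ := h.measurable_mu t m i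
    have hη := (h.measurable_aux t m i).mul_const (N.size m : ℝ)
    replace hQ := hQ.mono hmono le_rfl
    replace hY := hY.mono hmono le_rfl
    replace hZ := hZ.mono hmono le_rfl
    refine ⟨?_, ?_, ?_⟩
    · simp only [queueQ_succ]
      exact (((hQ.sub (hμ.const_mul 1)).sub hd).max measurable_const).add hr
    · simp only [queueY_succ]
      exact ((hY.sub hr).max measurable_const).add hη
    · simp only [queueZ_succ]
      refine Measurable.max (((hZ.add ?_).sub hd).sub ?_) measurable_const
      · exact Measurable.ite (measurableSet_lt measurable_const hQ)
          (measurable_const.sub hμ) measurable_const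
      · exact Measurable.ite (measurableSet_eq_fun hQ measurable_const) measurable_const
          measurable_const

theorem IsRun.bm_Q (h : N.IsRun P A W V T ℱ p η) (hA : N.IsArrivals P A) (t : ℕ) (m : M) (i : E) :
    BoundedMeasurable fun ω => N.queueQ 1 p t ω m i :=
  .of_mem_Icc ((h.measurable_queues t m i).1.mono (ℱ.le t) le_rfl) fun ω =>
    ⟨(h.isBounded hA).queueQ_nonneg 1 t ω m i, (h.isBounded hA).queueQ_le zero_le_one t ω m i⟩

theorem IsRun.bm_Y (h : N.IsRun P A W V T ℱ p η) (hA : N.IsArrivals P A) (hV : 0 < V) (t : ℕ)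
    (m : M) (i : E) : BoundedMeasurable fun ω => N.queueY p η t ω m i :=
  .of_mem_Icc ((h.measurable_queues t m i).2.1.mono (ℱ.le t) le_rfl) fun ω =>
    ⟨h.queueY_nonneg t ω m i, h.queueY_le hA hV t ω m i⟩

theorem IsRun.bm_Z (h : N.IsRun P A W V T ℱ p η) (hA : N.IsArrivals P A) (t : ℕ) (m : M) (i : E) :
    BoundedMeasurable fun ω => N.queueZ p t ω m i :=
  .of_mem_Icc ((h.measurable_queues t m i).2.2.mono (ℱ.le t) le_rfl) fun ω =>
    ⟨N.queueZ_nonneg p t ω m i, (h.isBounded hA).queueZ_le t ω m i⟩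

theorem IsRun.bm_mu (h : N.IsRun P A W V T ℱ p η) (t : ℕ) (m : M) (i : E) :
    BoundedMeasurable fun ω => p.mu t ω m i :=
  .of_mem_Icc ((h.measurable_mu t m i).mono (ℱ.le _) le_rfl) fun ω =>
    ⟨p.mu_nonneg t ω m i, p.mu_le_one t ω m i⟩

theorem IsRun.bm_r (h : N.IsRun P A W V T ℱ p η) (hA : N.IsArrivals P A) (t : ℕ) (m : M) (i : E) :
    BoundedMeasurable fun ω => p.r t ω m i :=
  .of_mem_Icc ((h.measurable_r (h.measurable_queues t m i).1 (h.measurable_queues t m i).2.1).mono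
    (ℱ.le _) le_rfl) fun ω => (h.isBounded hA).admission t ω m i

theorem IsRun.bm_d (h : N.IsRun P A W V T ℱ p η) (hA : N.IsArrivals P A) (t : ℕ) (m : M) (i : E) :
    BoundedMeasurable fun ω => p.d t ω m i :=
  .of_mem_Icc ((h.measurable_d (h.measurable_queues t m i).1 (h.measurable_queues t m i).2.2).mono
    (ℱ.le _) le_rfl) fun ω => (h.isBounded hA).drop t ω m i

theorem IsRun.bm_aux (h : N.IsRun P A W V T ℱ p η) (t : ℕ) (m : M) (i : E) :
    BoundedMeasurable fun ω => η t ω m i :=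
  .of_mem_Icc ((h.measurable_aux t m i).mono (ℱ.le _) le_rfl) fun ω => h.aux_mem t ω m i

theorem IsRun.bm_U (h : N.IsRun P A W V T ℱ p η) (t : ℕ) (m : M) (i : E) :
    BoundedMeasurable fun ω => N.U (η t ω m i * N.size m) :=
  N.boundedMeasurable_U ((h.bm_aux t m i).measurable.mul_const _) fun ω => h.aux_mul_mem t ω m i

theorem IsRun.bm_weight (h : N.IsRun P A W V T ℱ p η) (hA : N.IsArrivals P A) (t : ℕ) (m : M)
    (i : E) : BoundedMeasurable fun ω => N.weight p t ω m i :=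
  (h.bm_Q hA t m i).add (h.bm_Z hA t m i)

theorem IsRun.bm_slotUtility (h : N.IsRun P A W V T ℱ p η) (hA : N.IsArrivals P A) (t : ℕ) :
    BoundedMeasurable (N.slotUtility p η t) :=
  .sum₂ fun m i => (h.bm_U t m i).sub (((BoundedMeasurable.const _).mul (h.bm_d hA t m i)).mul
    (.const _))

theorem IsRun.bm_lyapunov (h : N.IsRun P A W V T ℱ p η) (hA : N.IsArrivals P A) (hV : 0 < V)
    (t : ℕ) : BoundedMeasurable (N.lyapunov p η t) :=
  .sum₂ fun m i => (BoundedMeasurable.const _).mul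
    (((h.bm_Q hA t m i).sq.add (h.bm_Y hA hV t m i).sq).add (h.bm_Z hA t m i).sq)

/-- The admission decision minimizes `(Q - Y) r` for each arrival, and the arrivals are independent
of the queues.  Hence no admission rate up to the mean arrivals does better. -/
theorem IsRun.integral_admission_nonpos [IsProbabilityMeasure P] (h : N.IsRun P A W V T ℱ p η)
    (hA : N.IsArrivals P A) (hV : 0 < V) {ρ : ℝ} (t : ℕ) (m : M) (i : E)
    (hρ : ρ ∈ Icc 0 (meanArrival P A m i)) :
    ∫ ω, (N.queueQ 1 p t ω m i - N.queueY p η t ω m i) * (p.r t ω m i - ρ) * N.size m ∂P ≤ 0 := by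
  have hQ := h.bm_Q hA t m i
  have hY := h.bm_Y hA hV t m i
  set X : Ω → ℝ := fun ω => max (N.queueY p η t ω m i - N.queueQ 1 p t ω m i) 0
  have hXm : Measurable[ℱ t] X :=
    ((h.measurable_queues t m i).2.1.sub (h.measurable_queues t m i).1).max measurable_const
  have hX : BoundedMeasurable X := by
    obtain ⟨C, hC⟩ := (hY.sub hQ).bounded
    refine .of_mem_Icc (hXm.mono (ℱ.le t) le_rfl) (a := 0) (b := C) fun ω =>
      ⟨le_max_right _ _, max_le ((le_abs_self _).trans (hC ω)) ((abs_nonneg _).trans (hC ω))⟩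
  have hind : IndepFun X (fun ω => A t ω m i) P := by
    have h1 := h.arrival_indep t
    refine indep_of_indep_of_le_left (indep_of_indep_of_le_right h1 ?_)
      (measurable_iff_comap_le.1 hXm)
    have h2 : Measurable fun a : M → E → ℝ => a m i := by fun_prop
    rintro s ⟨u, hu, rfl⟩
    exact ⟨_, h2 hu, rfl⟩
  have hmul : ∫ ω, X ω * A t ω m i ∂P = (∫ ω, X ω ∂P) * meanArrival P A m i := by
    rw [hind.integral_fun_mul_eq_mul_integral hX.measurable.aestronglyMeasurable
      (hA.boundedMeasurable t m i).measurable.aestronglyMeasurable, hA.integral_eq]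
  have hX0 : 0 ≤ ∫ ω, X ω ∂P := integral_nonneg fun ω => le_max_right _ _
  have hpt : ∀ ω, (N.queueQ 1 p t ω m i - N.queueY p η t ω m i) * (p.r t ω m i - ρ) * N.size m ≤
      (ρ * X ω - X ω * A t ω m i) * N.size m := by
    intro ω
    refine mul_le_mul_of_nonneg_right ?_ (Nat.cast_nonneg _)
    rw [h.admission]
    split_ifs with hc
    · simp only [X, max_eq_left hc.le]; linarith
    · simp only [X, max_eq_right (not_lt.1 hc)]; nlinarith [hρ.1]
  refine (integral_mono ((((hQ.sub hY).mul ((h.bm_r hA t m i).sub (.const ρ))).mul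
    (.const _)).integrable P) (((((BoundedMeasurable.const ρ).mul hX).sub
      (hX.mul (hA.boundedMeasurable t m i))).mul (.const _)).integrable P) hpt).trans ?_
  rw [integral_mul_const, integral_sub (((BoundedMeasurable.const ρ).mul hX).integrable P)
    ((hX.mul (hA.boundedMeasurable t m i)).integrable P), integral_const_mul, hmul]
  exact mul_nonpos_of_nonpos_of_nonneg (by nlinarith [hρ.2]) (Nat.cast_nonneg _)

/-- The expected drift in one slot. -/
theorem IsRun.integral_lyapunov_succ_le [IsProbabilityMeasure P] (h : N.IsRun P A W V T ℱ p η)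
    (hA : N.IsArrivals P A) (hV : 0 < V) {c : ℝ} {ρ dl σ : M → E → ℝ}
    (hR : N.IsRatePoint (meanArrival P A) c 0 ρ dl σ) (t : ℕ) :
    ∫ ω, N.lyapunov p η (t + 1) ω ∂P ≤ ∫ ω, N.lyapunov p η t ω ∂P
      + V * ∫ ω, N.slotUtility p η t ω ∂P + (N.B - Fintype.card E - V * N.rateUtility ρ dl)
      + ∫ ω, ∑ m, ∑ i, N.weight p t ω m i * (c * σ m i - p.mu t ω m i) ∂P := by
  have b1 := h.bm_lyapunov hA hV t
  have b2 := (BoundedMeasurable.const V).mul (h.bm_slotUtility hA t)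
  have b3 : BoundedMeasurable fun _ : Ω => N.B - Fintype.card E - V * N.rateUtility ρ dl := .const _
  have b4 : BoundedMeasurable fun ω =>
      ∑ m, ∑ i, N.weight p t ω m i * (c * σ m i - p.mu t ω m i) :=
    .sum₂ fun m i => (h.bm_weight hA t m i).mul ((BoundedMeasurable.const _).sub (h.bm_mu t m i))
  have b5' : ∀ m i, BoundedMeasurable fun ω =>
      (N.queueQ 1 p t ω m i - N.queueY p η t ω m i) * (p.r t ω m i - ρ m i) * N.size m := fun m i =>
    (((h.bm_Q hA t m i).sub (h.bm_Y hA hV t m i)).mul ((h.bm_r hA t m i).sub (.const _))).mul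
      (.const _)
  have b5 := BoundedMeasurable.sum₂ b5'
  have h1 := integral_mono ((h.bm_lyapunov hA hV (t + 1)).integrable P)
    (((((b1.add b2).add b3).add b4).add b5).integrable P)
    (h.lyapunov_succ_le hA hA.meanArrival_le hR t)
  rw [integral_add ((((b1.add b2).add b3).add b4).integrable P) (b5.integrable P),
    integral_add (((b1.add b2).add b3).integrable P) (b4.integrable P),
    integral_add ((b1.add b2).integrable P) (b3.integrable P),
    integral_add (b1.integrable P) (b2.integrable P), integral_const_mul,
    BoundedMeasurable.integral_sum₂ b5', integral_const, probReal_univ, one_smul] at h1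
  have h2 : ∑ m, ∑ i, ∫ ω, (N.queueQ 1 p t ω m i - N.queueY p η t ω m i) * (p.r t ω m i - ρ m i)
      * N.size m ∂P ≤ 0 :=
    Finset.sum_nonpos fun m _ => Finset.sum_nonpos fun i _ =>
      h.integral_admission_nonpos hA hV t m i (hR.admission m i)
  linarith

end Run

end Network

/-! ### Drift over a super slot -/

namespace Network

variable {Ω M E : Type*}

theorem IsRatePoint.service_le_one [Fintype M] [Fintype E] {N : Network M E} {a : M → E → ℝ}
    {c e : ℝ} {ρ dl σ : M → E → ℝ} (hR : N.IsRatePoint a c e ρ dl σ) (m : M) (i : E) :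
    σ m i ≤ 1 := by
  classical
  have h1 := hR.service_le (fun j => if j = i then 1 else 0)
    (fun j => by split_ifs <;> norm_num) 1 fun χ _ => by
      rw [Finset.sum_ite_eq']
      split_ifs <;> norm_num
  simp only [ite_mul, one_mul, zero_mul, Finset.sum_ite_eq', Finset.mem_univ, if_true] at h1
  exact (Finset.single_le_sum (f := fun m => σ m i) (fun m _ => hR.service_nonneg m i)
    (Finset.mem_univ m)).trans h1

theorem sum_range_cast (n : ℕ) : ∑ j ∈ Finset.range n, (j : ℝ) = n * ((n : ℝ) - 1) / 2 := by
  induction n with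
  | zero => simp
  | succ n ih => rw [Finset.sum_range_succ, ih]; push_cast; ring

theorem sum_scheduled [Fintype E] (p : Policy Ω M E) (t : ℕ) (ω : Ω) (f : E → ℝ) :
    ∑ i ∈ p.x t ω, f i =
      ∑ χ : Finset E, ({ω' | p.x t ω' = χ}.indicator (fun _ => (1 : ℝ)) ω) * ∑ i ∈ χ, f i := by
  classical
  rw [Finset.sum_eq_single (p.x t ω)]
  · simp
  · intro χ _ hχ
    rw [indicator_of_notMem (by simpa using Ne.symm hχ), zero_mul]
  · simp

theorem one_le_maxSize [Fintype M] [Nonempty M] (N : Network M E) : 1 ≤ N.maxSize := by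
  obtain ⟨m⟩ := ‹Nonempty M›
  exact (N.size_pos m).trans (Finset.le_sup (Finset.mem_univ m))

section Run

variable [Fintype M] [Nonempty M] [Fintype E] [mΩ : MeasurableSpace Ω] {N : Network M E}
  {P : Measure Ω} {A : ℕ → Ω → M → E → ℝ} {W : ℕ} {V : ℝ} {T : ℕ} {ℱ : Filtration ℕ mΩ}
  {p : Policy Ω M E} {η : ℕ → Ω → M → E → ℝ}

theorem IsRun.measurable_linkWeight (h : N.IsRun P A W V T ℱ p η) (t : ℕ) (i : E) :
    Measurable[ℱ t] fun ω => N.linkWeight p t ω i := by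
  have h1 : Measurable[ℱ t]
      (Finset.univ.sup' Finset.univ_nonempty fun (m : M) ω => N.weight p t ω m i) :=
    Finset.sup'_induction (p := fun f => Measurable[ℱ t] f) _ _ (fun f hf g hg => hf.sup hg)
      fun m _ => (h.measurable_queues t m i).1.add (h.measurable_queues t m i).2.2
  convert h1 using 1
  ext ω
  rw [linkWeight, Finset.sup'_apply]

theorem IsRun.bm_linkWeight (h : N.IsRun P A W V T ℱ p η) (hA : N.IsArrivals P A) (t : ℕ)
    (i : E) : BoundedMeasurable fun ω => N.linkWeight p t ω i := by
  have hb := h.isBounded hA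
  obtain ⟨C, hC⟩ := (BoundedMeasurable.sum Finset.univ fun m _ => h.bm_weight hA t m i).bounded
  refine .of_mem_Icc ((h.measurable_linkWeight t i).mono (ℱ.le t) le_rfl) (a := 0) (b := C)
    fun ω => ⟨hb.linkWeight_nonneg t ω i, Finset.sup'_le _ _ fun m _ => ?_⟩
  exact (Finset.single_le_sum (f := fun m => N.weight p t ω m i)
    (fun m _ => hb.weight_nonneg t ω m i) (Finset.mem_univ m)).trans
      ((le_abs_self _).trans (hC ω))

open Classical in
theorem IsRun.bm_scheduled (h : N.IsRun P A W V T ℱ p η) (t : ℕ) (χ : Finset E) :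
    BoundedMeasurable ({ω | p.x t ω = χ}.indicator fun _ => (1 : ℝ)) :=
  .of_mem_Icc (measurable_const.indicator (ℱ.le (t + 1) _ (h.schedule_adapted t χ)))
    (a := 0) (b := 1) fun ω => by
      by_cases hω : ω ∈ {ω | p.x t ω = χ} <;> simp [hω]

theorem IsRun.bm_scheduledWeight (h : N.IsRun P A W V T ℱ p η) (hA : N.IsArrivals P A) (t : ℕ) :
    BoundedMeasurable fun ω => ∑ i ∈ p.x t ω, N.linkWeight p t ω i := by
  simp_rw [sum_scheduled p t]
  exact .sum _ fun χ _ => (h.bm_scheduled t χ).mul (.sum _ fun i _ => h.bm_linkWeight hA t i)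

/-- The expected weight of the schedule drawn at the start of a super slot is at least that of any
feasible service rates, up to the entropy of the schedule. -/
theorem IsRun.integral_scheduledWeight_ge [IsProbabilityMeasure P]
    (hW : ∀ i : E, ∃ b : E → Fin W, i ∈ N.control (fun j => (b j : ℕ)))
    (h : N.IsRun P A W V T ℱ p η) (hA : N.IsArrivals P A) {a : M → E → ℝ} {c e : ℝ}
    {ρ dl σ : M → E → ℝ} (hR : N.IsRatePoint a c e ρ dl σ) (n : ℕ) :
    ∫ ω, ∑ m, ∑ i, N.linkWeight p (n * T) ω i * σ m i ∂P ≤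
      ∫ ω, ∑ i ∈ p.x (n * T) ω, N.linkWeight p (n * T) ω i ∂P + Fintype.card E := by
  set t := n * T
  set I : Finset E → Ω → ℝ := fun χ => {ω | p.x t ω = χ}.indicator fun _ => (1 : ℝ)
  set g : Finset E → Ω → ℝ := fun χ ω => ∑ i ∈ χ, N.linkWeight p t ω i
  have hI : ∀ χ, BoundedMeasurable (I χ) := fun χ => h.bm_scheduled t χ
  have hg : ∀ χ, BoundedMeasurable (g χ) := fun χ =>
    .sum _ fun i _ => h.bm_linkWeight hA t i
  have hgm : ∀ χ, StronglyMeasurable[ℱ t] (g χ) := fun χ =>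
    (Finset.measurable_fun_sum χ fun i _ => h.measurable_linkWeight t i).stronglyMeasurable
  have hce : ∀ χ, P[I χ * g χ | ℱ t] =ᵐ[P] P[I χ | ℱ t] * g χ := fun χ =>
    condExp_mul_of_stronglyMeasurable_right (hgm χ) (((hI χ).mul (hg χ)).integrable P)
      ((hI χ).integrable P)
  have hint : ∀ χ, Integrable (fun ω => (P[I χ | ℱ t]) ω * g χ ω) P := fun χ =>
    integrable_condExp.congr (hce χ)
  have heq : ∀ χ, ∫ ω, (P[I χ | ℱ t]) ω * g χ ω ∂P = ∫ ω, I χ ω * g χ ω ∂P := fun χ => by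
    have h1 := integral_condExp (μ := P) (f := I χ * g χ) (ℱ.le t)
    rw [integral_congr_ae (hce χ)] at h1
    exact h1
  have hbm : BoundedMeasurable fun ω => ∑ m, ∑ i, N.linkWeight p t ω i * σ m i :=
    .sum₂ fun m i => (h.bm_linkWeight hA t i).mul (.const _)
  have hae : ∀ᵐ ω ∂P, ∑ m, ∑ i, N.linkWeight p t ω i * σ m i ≤
      ∑ χ, (P[I χ | ℱ t]) ω * g χ ω + Fintype.card E := by
    filter_upwards [h.schedule_law n] with ω hω
    exact hR.service_le _ (fun i => (h.isBounded hA).linkWeight_nonneg t ω i) _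
      fun χ hχ => hω.weight_le hW hχ
  have hint' : Integrable (fun ω => ∑ χ, (P[I χ | ℱ t]) ω * g χ ω) P :=
    integrable_finsetSum _ fun χ _ => hint χ
  refine (integral_mono_ae (hbm.integrable P) (hint'.add (integrable_const _)) hae).trans ?_
  simp only [Pi.add_apply]
  rw [integral_add hint' (integrable_const _), integral_finsetSum _ fun χ _ => hint χ]
  simp_rw [heq]
  rw [← integral_finsetSum _ fun χ _ => ((hI χ).mul (hg χ)).integrable P]
  simp_rw [sum_scheduled p t]
  simp [I, g]

/-- The weight gained by rates that use the fraction `c` of the capacity, over the weight served by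
the algorithm in a slot of a super slot. -/
theorem IsRun.weight_gap_le (h : N.IsRun P A W V T ℱ p η) (hA : N.IsArrivals P A)
    {a : M → E → ℝ} {c e : ℝ} (hc : 0 ≤ c) (hc1 : c ≤ 1) {ρ dl σ : M → E → ℝ}
    (hR : N.IsRatePoint a c e ρ dl σ) (n j : ℕ) (ω : Ω) :
    ∑ m, ∑ i, N.weight p (n * T + j) ω m i * (c * σ m i - p.mu (n * T + j) ω m i) ≤
      c * ∑ m, ∑ i, N.linkWeight p (n * T) ω i * σ m i + j * N.B''
      + if j + N.maxSize ≤ T then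
          j * N.B' - ∑ i ∈ p.x (n * T) ω, N.linkWeight p (n * T) ω i else 0 := by
  have hb := h.isBounded hA
  have h1 : ∑ m, ∑ i, N.weight p (n * T + j) ω m i * (c * σ m i) ≤
      c * ∑ m, ∑ i, N.linkWeight p (n * T) ω i * σ m i + j * N.B'' := by
    unfold B''
    rw [Finset.mul_sum, Finset.mul_sum, ← Finset.sum_add_distrib]
    refine Finset.sum_le_sum fun m _ => ?_
    rw [Finset.mul_sum, Finset.mul_sum, ← Finset.sum_add_distrib]
    refine Finset.sum_le_sum fun i _ => ?_
    have e1 := hb.weight_add_le (n * T) j ω m i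
    have e2 : N.weight p (n * T) ω m i ≤ N.linkWeight p (n * T) ω i :=
      Finset.le_sup' (fun m => N.weight p (n * T) ω m i) (Finset.mem_univ m)
    have e3 := hR.service_nonneg m i
    have e4 := hR.service_le_one m i
    have e5 : N.Amax m i * N.size m + N.eps m i ≤ (N.Amax m i * N.size m) ^ 2 + N.eps m i ^ 2
        + 2 * N.dmax m i * N.size m * (1 + N.dmax m i * N.size m) := by
      have f1 := N.eps_le m i
      have f2 := N.Amax_mul_le m i
      nlinarith [sq_nonneg (N.Amax m i * N.size m), sq_nonneg (N.eps m i),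
        sq_nonneg (N.dmax m i * N.size m)]
    have e6 : 0 ≤ N.Amax m i * N.size m + N.eps m i :=
      add_nonneg (N.Amax_mul_nonneg m i) (N.eps_pos m i).le
    have e7 : c * σ m i ≤ 1 := mul_le_one₀ hc1 e3 e4
    calc N.weight p (n * T + j) ω m i * (c * σ m i)
        ≤ (N.linkWeight p (n * T) ω i + j * (N.Amax m i * N.size m + N.eps m i)) * (c * σ m i) := by
          gcongr
          linarith
      _ = c * (N.linkWeight p (n * T) ω i * σ m i)
          + j * (N.Amax m i * N.size m + N.eps m i) * (c * σ m i) := by ring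
      _ ≤ c * (N.linkWeight p (n * T) ω i * σ m i)
          + j * (N.Amax m i * N.size m + N.eps m i) * 1 := by gcongr
      _ ≤ _ := by
          rw [mul_one]
          gcongr
  have h2 : (if j + N.maxSize ≤ T then ∑ i ∈ p.x (n * T) ω, N.linkWeight p (n * T) ω i
      - j * N.B' else 0) ≤
      ∑ m, ∑ i, N.weight p (n * T + j) ω m i * p.mu (n * T + j) ω m i := by
    split_ifs with hj
    · exact h.served_weight_ge hA n hj ω
    · exact Finset.sum_nonneg fun m _ => Finset.sum_nonneg fun i _ =>
        mul_nonneg (hb.weight_nonneg _ _ _ _) (p.mu_nonneg _ _ _ _)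
  simp only [mul_sub, Finset.sum_sub_distrib]
  split_ifs at h2 ⊢ <;> linarith

/-- The loss of the algorithm in the drift bound over a super slot, per slot. -/
noncomputable def slotLoss (N : Network M E) (T : ℕ) : ℝ :=
  N.B + N.B' * (((T : ℝ) - N.maxSize + 1) * ((T : ℝ) - N.maxSize)) / (2 * T)
    + ((T : ℝ) - 1) / 2 * N.B''

/-- The expected drift over a super slot. -/
theorem IsRun.superslot_drift [IsProbabilityMeasure P]
    (hW : ∀ i : E, ∃ b : E → Fin W, i ∈ N.control (fun j => (b j : ℕ)))
    (h : N.IsRun P A W V T ℱ p η) (hA : N.IsArrivals P A) (hV : 0 < V) (hT : N.maxSize ≤ T)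
    {c : ℝ} (hc : 0 ≤ c) (hcT : c * T ≤ (T : ℝ) - N.maxSize + 1) {ρ dl σ : M → E → ℝ}
    (hR : N.IsRatePoint (meanArrival P A) c 0 ρ dl σ) (n : ℕ) :
    ∫ ω, N.lyapunov p η ((n + 1) * T) ω ∂P ≤ ∫ ω, N.lyapunov p η (n * T) ω ∂P
      + ∑ j ∈ Finset.range T, V * ∫ ω, N.slotUtility p η (n * T + j) ω ∂P
      + T * (N.slotLoss T - V * N.rateUtility ρ dl) := by
  have hs := N.one_le_maxSize
  have hT0 : (0 : ℝ) < T := by exact_mod_cast (by omega : 0 < T)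
  have hs' : (1 : ℝ) ≤ N.maxSize := by exact_mod_cast hs
  have hc1 : c ≤ 1 := by
    by_contra! hlt
    nlinarith
  set S : ℕ := T - N.maxSize + 1
  have hS : (S : ℝ) = (T : ℝ) - N.maxSize + 1 := by
    simp only [S]; push_cast [Nat.cast_sub hT]; ring
  set X := ∫ ω, ∑ m, ∑ i, N.linkWeight p (n * T) ω i * σ m i ∂P
  set Y := ∫ ω, ∑ i ∈ p.x (n * T) ω, N.linkWeight p (n * T) ω i ∂P
  have hXY : X ≤ Y + Fintype.card E := h.integral_scheduledWeight_ge hW hA hR n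
  have hX0 : 0 ≤ X := integral_nonneg fun ω => Finset.sum_nonneg fun m _ =>
    Finset.sum_nonneg fun i _ => mul_nonneg ((h.isBounded hA).linkWeight_nonneg _ _ _)
      (hR.service_nonneg m i)
  have bX : BoundedMeasurable fun ω => ∑ m, ∑ i, N.linkWeight p (n * T) ω i * σ m i :=
    .sum₂ fun m i => (h.bm_linkWeight hA _ i).mul (.const _)
  have bY := h.bm_scheduledWeight hA (n * T)
  have hgap : ∀ j : ℕ, ∫ ω, ∑ m, ∑ i, N.weight p (n * T + j) ω m i *
      (c * σ m i - p.mu (n * T + j) ω m i) ∂P ≤ c * X + j * N.B''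
        + if j < S then j * N.B' - Y else 0 := by
    intro j
    have hiff : j + N.maxSize ≤ T ↔ j < S := by simp only [S]; omega
    have b1 : BoundedMeasurable fun ω =>
        ∑ m, ∑ i, N.weight p (n * T + j) ω m i * (c * σ m i - p.mu (n * T + j) ω m i) :=
      .sum₂ fun m i => (h.bm_weight hA _ m i).mul ((BoundedMeasurable.const _).sub (h.bm_mu _ m i))
    have h1 := h.weight_gap_le hA hc hc1 hR n j
    simp only [hiff] at h1
    have b2 := ((BoundedMeasurable.const c).mul bX).add (.const (j * N.B''))
    have b3 := (BoundedMeasurable.const (j * N.B')).sub bY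
    by_cases hj : j < S
    · simp only [if_pos hj] at h1 ⊢
      have h2 := integral_mono (b1.integrable P) ((b2.add b3).integrable P) h1
      rw [integral_add (b2.integrable P) (b3.integrable P),
        integral_add (((BoundedMeasurable.const c).mul bX).integrable P) (integrable_const _),
        integral_sub (integrable_const _) (bY.integrable P), integral_const_mul, integral_const,
        integral_const, probReal_univ, one_smul, one_smul] at h2
      exact h2
    · simp only [if_neg hj, add_zero] at h1 ⊢
      have h2 := integral_mono (b1.integrable P) (b2.integrable P) h1
      rw [integral_add (((BoundedMeasurable.const c).mul bX).integrable P) (integrable_const _),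
        integral_const_mul, integral_const, probReal_univ, one_smul] at h2
      exact h2
  -- telescoping over the first `k` slots of the super slot
  have htel : ∀ k : ℕ, ∫ ω, N.lyapunov p η (n * T + k) ω ∂P ≤ ∫ ω, N.lyapunov p η (n * T) ω ∂P
      + ∑ j ∈ Finset.range k, (V * ∫ ω, N.slotUtility p η (n * T + j) ω ∂P
        + (N.B - Fintype.card E - V * N.rateUtility ρ dl)
        + (c * X + j * N.B'' + if j < S then j * N.B' - Y else 0)) := by
    intro k
    induction k with
    | zero => simp
    | succ k ih =>
      have h1 := h.integral_lyapunov_succ_le hA hV hR (n * T + k)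
      have h2 := hgap k
      rw [Finset.sum_range_succ, ← add_assoc (n * T)]
      linarith
  have h1 := htel T
  have hfil : (Finset.range T).filter (· < S) = Finset.range S := by
    ext j
    simp only [Finset.mem_filter, Finset.mem_range, S]
    omega
  rw [show n * T + T = (n + 1) * T by ring] at h1
  simp only [Finset.sum_add_distrib, ← Finset.sum_filter, hfil, Finset.sum_sub_distrib,
    ← Finset.sum_mul, sum_range_cast, Finset.sum_const, Finset.card_range, nsmul_eq_mul] at h1
  have hloss : T * N.slotLoss T = T * N.B + S * ((S : ℝ) - 1) / 2 * N.B'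
      + T * ((T : ℝ) - 1) / 2 * N.B'' := by
    rw [slotLoss, hS]
    field_simp
    ring
  rw [mul_sub, hloss]
  -- the entropy of the schedule is paid for by the margin in the constant `B`
  have h2 : c * T * X ≤ S * X := by rw [hS]; gcongr
  have h3 : (S : ℝ) * X ≤ S * (Y + Fintype.card E) := by gcongr
  have h4 : (S : ℝ) * Fintype.card E ≤ T * Fintype.card E := by
    have : S ≤ T := by simp only [S]; omega
    gcongr
  linarith

/-- The utilities summed over whole super slots, since the Lyapunov function starts at zero and stays
non-negative. -/
theorem IsRun.sum_slotUtility_ge [IsProbabilityMeasure P]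
    (hW : ∀ i : E, ∃ b : E → Fin W, i ∈ N.control (fun j => (b j : ℕ)))
    (h : N.IsRun P A W V T ℱ p η) (hA : N.IsArrivals P A) (hV : 0 < V) (hT : N.maxSize ≤ T)
    {c : ℝ} (hc : 0 ≤ c) (hcT : c * T ≤ (T : ℝ) - N.maxSize + 1) {ρ dl σ : M → E → ℝ}
    (hR : N.IsRatePoint (meanArrival P A) c 0 ρ dl σ) (n : ℕ) :
    (n * T : ℕ) * (V * N.rateUtility ρ dl - N.slotLoss T) ≤
      V * ∑ t ∈ Finset.range (n * T), ∫ ω, N.slotUtility p η t ω ∂P := by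
  have hind : ∀ n : ℕ, ∫ ω, N.lyapunov p η (n * T) ω ∂P ≤
      V * ∑ t ∈ Finset.range (n * T), ∫ ω, N.slotUtility p η t ω ∂P
        - (n * T : ℕ) * (V * N.rateUtility ρ dl - N.slotLoss T) := by
    intro n
    induction n with
    | zero => simp [lyapunov, queueQ, queueY, queueZ]
    | succ n ih =>
      have h1 := h.superslot_drift hW hA hV hT hc hcT hR n
      rw [show Finset.range ((n + 1) * T) = Finset.range (n * T + T) by rw [add_mul, one_mul],
        Finset.sum_range_add, mul_add, Finset.mul_sum (Finset.range T)]
      push_cast at ih ⊢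
      linarith
  have h0 : 0 ≤ ∫ ω, N.lyapunov p η (n * T) ω ∂P := integral_nonneg fun ω =>
    Finset.sum_nonneg fun m _ => Finset.sum_nonneg fun i _ => by positivity
  linarith [hind n]

end Run

end Network

/-! ### Time averages and the utility of the algorithm -/

namespace Network

variable {Ω M E : Type*}

section

variable [MeasurableSpace Ω] {P : Measure Ω} {f g : ℕ → Ω → ℝ}

theorem timeAvg_add [IsFiniteMeasure P] (hf : ∀ t, BoundedMeasurable (f t))
    (hg : ∀ t, BoundedMeasurable (g t)) (t : ℕ) :
    timeAvg P (fun τ ω => f τ ω + g τ ω) t = timeAvg P f t + timeAvg P g t := by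
  simp only [timeAvg]
  rw [← mul_add, ← Finset.sum_add_distrib]
  congr 1
  exact Finset.sum_congr rfl fun τ _ =>
    integral_add ((hf τ).integrable P) ((hg τ).integrable P)

theorem timeAvg_const_mul (c : ℝ) (f : ℕ → Ω → ℝ) (t : ℕ) :
    timeAvg P (fun τ ω => c * f τ ω) t = c * timeAvg P f t := by
  simp only [timeAvg, integral_const_mul, ← Finset.mul_sum]
  ring

theorem timeAvg_mul_const (c : ℝ) (f : ℕ → Ω → ℝ) (t : ℕ) :
    timeAvg P (fun τ ω => f τ ω * c) t = timeAvg P f t * c := by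
  simp only [mul_comm _ c, timeAvg_const_mul]

theorem timeAvg_sub [IsFiniteMeasure P] (hf : ∀ t, BoundedMeasurable (f t))
    (hg : ∀ t, BoundedMeasurable (g t)) (t : ℕ) :
    timeAvg P (fun τ ω => f τ ω - g τ ω) t = timeAvg P f t - timeAvg P g t := by
  have h1 := timeAvg_add (P := P) hf (fun t => (BoundedMeasurable.const (-1)).mul (hg t)) t
  rw [timeAvg_const_mul] at h1
  simp only [sub_eq_add_neg, neg_one_mul] at h1 ⊢
  exact h1

theorem timeAvg_sum₂ [IsFiniteMeasure P] [Fintype M] [Fintype E] {f : M → E → ℕ → Ω → ℝ}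
    (hf : ∀ m i t, BoundedMeasurable (f m i t)) (t : ℕ) :
    timeAvg P (fun τ ω => ∑ m, ∑ i, f m i τ ω) t = ∑ m, ∑ i, timeAvg P (f m i) t := by
  simp only [timeAvg, ← Finset.mul_sum]
  congr 1
  rw [Finset.sum_congr rfl fun τ _ => BoundedMeasurable.integral_sum₂ (fun m i => hf m i τ) P,
    Finset.sum_comm]
  exact Finset.sum_congr rfl fun m _ => Finset.sum_comm

theorem timeAvg_mono [IsFiniteMeasure P] (hf : ∀ t, BoundedMeasurable (f t))
    (hg : ∀ t, BoundedMeasurable (g t)) (h : ∀ t ω, f t ω ≤ g t ω) (t : ℕ) :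
    timeAvg P f t ≤ timeAvg P g t := by
  unfold timeAvg
  refine mul_le_mul_of_nonneg_left (Finset.sum_le_sum fun τ _ => ?_) (by positivity)
  exact integral_mono ((hf τ).integrable P) ((hg τ).integrable P) (h τ)

theorem timeAvg_const [IsProbabilityMeasure P] (c : ℝ) {t : ℕ} (ht : t ≠ 0) :
    timeAvg P (fun _ _ => c) t = c := by
  simp [timeAvg, ht]

theorem timeAvg_mem_Icc [IsProbabilityMeasure P] {b : ℝ} (hf : ∀ t, BoundedMeasurable (f t))
    (h : ∀ t ω, f t ω ∈ Icc 0 b) (t : ℕ) : timeAvg P f t ∈ Icc 0 b := by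
  refine ⟨mul_nonneg (by positivity) (Finset.sum_nonneg fun τ _ =>
    integral_nonneg fun ω => (h τ ω).1), ?_⟩
  rcases eq_or_ne t 0 with rfl | ht
  · obtain ⟨ω⟩ := nonempty_of_isProbabilityMeasure P
    simpa [timeAvg] using (h 0 ω).1.trans (h 0 ω).2
  · rw [← timeAvg_const (P := P) b ht]
    exact timeAvg_mono hf (fun _ => .const b) (fun t ω => (h t ω).2) t

/-- If `q` gains at least `f` in each slot, the time average of `f` is at most `𝔼 q(t) / t`. -/
theorem timeAvg_le_of_increment [IsProbabilityMeasure P] {q : ℕ → Ω → ℝ} (h0 : ∀ ω, q 0 ω = 0)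
    (hf : ∀ t, BoundedMeasurable (f t)) (hq : ∀ t, BoundedMeasurable (q t))
    (h : ∀ t ω, q t ω + f t ω ≤ q (t + 1) ω) (t : ℕ) :
    timeAvg P f t ≤ (∫ ω, q t ω ∂P) / t := by
  have h1 : ∀ t, ∑ τ ∈ Finset.range t, ∫ ω, f τ ω ∂P ≤ ∫ ω, q t ω ∂P := by
    intro t
    induction t with
    | zero => simp [h0]
    | succ t ih =>
      have h2 := integral_mono (((hq t).add (hf t)).integrable P) ((hq (t + 1)).integrable P) (h t)
      rw [integral_add ((hq t).integrable P) ((hf t).integrable P)] at h2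
      rw [Finset.sum_range_succ]
      linarith
  rw [timeAvg, one_div, inv_mul_eq_div]
  gcongr
  exact h1 t

/-- Jensen's inequality for the utility of time averages. -/
theorem timeAvg_U_le [IsProbabilityMeasure P] (N : Network M E) {b : ℝ}
    (hf : ∀ t, BoundedMeasurable (f t)) (h : ∀ t ω, f t ω ∈ Icc 0 b) {t : ℕ} (ht : t ≠ 0) :
    timeAvg P (fun τ ω => N.U (f τ ω)) t ≤ N.U (timeAvg P f t) := by
  have h1 : ∀ τ, ∫ ω, N.U (f τ ω) ∂P ≤ N.U (∫ ω, f τ ω ∂P) := fun τ =>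
    N.U_concave.le_map_integral N.U_diff.continuousOn isClosed_Ici
      (ae_of_all _ fun ω => (h τ ω).1) ((hf τ).integrable P)
      ((N.boundedMeasurable_U (hf τ).measurable (h τ)).integrable P)
  have h2 := N.U_concave.le_map_sum (t := Finset.range t) (w := fun _ => 1 / (t : ℝ))
    (p := fun τ => ∫ ω, f τ ω ∂P) (fun _ _ => by positivity) (by simp [ht])
    (fun τ _ => mem_Ici.2 (integral_nonneg fun ω => (h τ ω).1))
  simp only [smul_eq_mul, ← Finset.mul_sum] at h2
  refine le_trans ?_ h2
  unfold timeAvg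
  gcongr with τ
  exact h1 τ

/-- A queue with bounded upward increments whose time averages stay bounded grows sublinearly, as
follows by summing the increments of its square. -/
theorem eventually_le_mul_of_avg_le {q : ℕ → ℝ} {a C : ℝ} (ha : 0 ≤ a) (h0 : q 0 = 0)
    (hq : ∀ t, 0 ≤ q t) (hstep : ∀ t, q (t + 1) ≤ q t + a)
    (hC : ∀ᶠ t : ℕ in atTop, (1 / (t : ℝ)) * ∑ τ ∈ Finset.range t, q τ ≤ C) {e : ℝ} (he : 0 < e) :
    ∀ᶠ t : ℕ in atTop, q t / t ≤ e := by
  have hsq : ∀ t, q t ^ 2 ≤ 2 * a * ∑ τ ∈ Finset.range t, q τ + a ^ 2 * t := by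
    intro t
    induction t with
    | zero => simp [h0]
    | succ t ih =>
      have h1 : q (t + 1) ^ 2 ≤ (q t + a) ^ 2 := by
        have := hq (t + 1)
        have := hstep t
        gcongr
      rw [Finset.sum_range_succ]
      push_cast
      linarith
  filter_upwards [hC, eventually_gt_atTop 0, eventually_ge_atTop ⌈(2 * a * C + a ^ 2) / e ^ 2⌉₊]
    with t h1 h2 h3
  have ht : (0 : ℝ) < t := by exact_mod_cast h2
  rw [div_le_iff₀ ht]
  rw [one_div, inv_mul_eq_div, div_le_iff₀ ht] at h1
  have h4 : (2 * a * C + a ^ 2) / e ^ 2 ≤ t := Nat.ceil_le.1 h3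
  rw [div_le_iff₀ (by positivity)] at h4
  have h5 : q t ^ 2 ≤ (e * t) ^ 2 := by
    calc q t ^ 2 ≤ 2 * a * ∑ τ ∈ Finset.range t, q τ + a ^ 2 * t := hsq t
      _ ≤ 2 * a * (C * t) + a ^ 2 * t := by gcongr
      _ = (2 * a * C + a ^ 2) * t := by ring
      _ ≤ (t * e ^ 2) * t := by gcongr
      _ = (e * t) ^ 2 := by ring
  exact (pow_le_pow_iff_left₀ (hq t) (by positivity) two_ne_zero).1 h5

end

/-- The net utility of a policy with measurable decisions is bounded in time. -/
theorem IsBounded.horizonUtility_bounded [Fintype M] [Fintype E] [MeasurableSpace Ω]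
    {N : Network M E} {P : Measure Ω} [IsProbabilityMeasure P] {p : Policy Ω M E}
    (h : N.IsBounded p) (hr : ∀ t m i, BoundedMeasurable fun ω => p.r t ω m i)
    (hd : ∀ t m i, BoundedMeasurable fun ω => p.d t ω m i) (t : ℕ) :
    N.horizonUtility P p t ∈ Icc (-∑ m, ∑ i, N.β * N.dmax m i * N.size m)
      (∑ m, ∑ i, N.U (N.Amax m i * N.size m)) := by
  have hpair : ∀ m i, N.U (timeAvg P (fun τ ω => p.r τ ω m i) t * N.size m)
      - N.β * timeAvg P (fun τ ω => p.d τ ω m i) t * N.size m ∈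
      Icc (-(N.β * N.dmax m i * N.size m)) (N.U (N.Amax m i * N.size m)) := by
    intro m i
    have hβ := N.β_pos
    obtain ⟨h1, h2⟩ := timeAvg_mem_Icc (P := P) (fun t => hr t m i)
      (fun t ω => h.admission t ω m i) t
    obtain ⟨h3, h4⟩ := timeAvg_mem_Icc (P := P) (fun t => hd t m i) (fun t ω => h.drop t ω m i) t
    obtain ⟨h5, h6⟩ := N.U_nonneg_le (b := N.Amax m i * N.size m)
      (y := timeAvg P (fun τ ω => p.r τ ω m i) t * N.size m) ⟨by positivity, by gcongr⟩
    have h7 : N.β * timeAvg P (fun τ ω => p.d τ ω m i) t * N.size m ≤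
      N.β * N.dmax m i * N.size m := by gcongr
    have h8 : 0 ≤ N.β * timeAvg P (fun τ ω => p.d τ ω m i) t * N.size m := by positivity
    exact ⟨by linarith, by linarith⟩
  simp only [← Finset.sum_neg_distrib]
  exact ⟨Finset.sum_le_sum fun m _ => Finset.sum_le_sum fun i _ => (hpair m i).1,
    Finset.sum_le_sum fun m _ => Finset.sum_le_sum fun i _ => (hpair m i).2⟩

section Run

variable [Fintype M] [Nonempty M] [Fintype E] [mΩ : MeasurableSpace Ω] {N : Network M E}
  {P : Measure Ω} {A : ℕ → Ω → M → E → ℝ} {W : ℕ} {V : ℝ} {T : ℕ} {ℱ : Filtration ℕ mΩ}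
  {p : Policy Ω M E} {η : ℕ → Ω → M → E → ℝ}

/-- The admissions follow the auxiliary variables, since the queues `Y` are bounded. -/
theorem IsRun.timeAvg_slotUtility_le [IsProbabilityMeasure P] (h : N.IsRun P A W V T ℱ p η)
    (hA : N.IsArrivals P A) (hV : 0 < V) {t : ℕ} (ht : t ≠ 0) :
    timeAvg P (N.slotUtility p η) t ≤ N.horizonUtility P p t
      + (∑ m, ∑ i : E, derivWithin N.U (Ici 0) 0 *
        (V * derivWithin N.U (Ici 0) 0 + N.Amax m i * N.size m)) / t := by
  have hpos : (0 : ℝ) < t := by positivity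
  have hb := h.isBounded hA
  have hU' := N.derivWithin_U_nonneg
  unfold slotUtility rateUtility horizonUtility
  rw [timeAvg_sum₂ fun m i t => (h.bm_U t m i).sub
    (((BoundedMeasurable.const _).mul (h.bm_d hA t m i)).mul (.const _)), Finset.sum_div,
    ← Finset.sum_add_distrib]
  refine Finset.sum_le_sum fun m _ => ?_
  rw [Finset.sum_div, ← Finset.sum_add_distrib]
  refine Finset.sum_le_sum fun i _ => ?_
  have bηs : ∀ t, BoundedMeasurable fun ω => η t ω m i * N.size m := fun t =>
    (h.bm_aux t m i).mul (.const _)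
  have brs : ∀ t, BoundedMeasurable fun ω => p.r t ω m i * N.size m := fun t =>
    (h.bm_r hA t m i).mul (.const _)
  rw [timeAvg_sub (fun t => h.bm_U t m i) (fun t =>
    ((BoundedMeasurable.const _).mul (h.bm_d hA t m i)).mul (.const _)), timeAvg_mul_const,
    timeAvg_const_mul]
  set D := derivWithin N.U (Ici 0) 0
  set C := V * D + N.Amax m i * N.size m
  have hC : 0 ≤ C := add_nonneg (by positivity) (N.Amax_mul_nonneg m i)
  have h1 := timeAvg_U_le (P := P) N bηs (fun t ω => h.aux_mul_mem t ω m i) ht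
  have h2 := timeAvg_le_of_increment (P := P) (q := fun t ω => N.queueY p η t ω m i)
    (f := fun t ω => η t ω m i * N.size m - p.r t ω m i * N.size m) (fun ω => rfl)
    (fun t => (bηs t).sub (brs t)) (fun t => h.bm_Y hA hV t m i) (fun t ω => by
      rw [queueY_succ]
      linarith [le_max_left (N.queueY p η t ω m i - p.r t ω m i * N.size m) 0]) t
  rw [timeAvg_sub bηs brs] at h2
  have h3 : ∫ ω, N.queueY p η t ω m i ∂P ≤ C := by
    have := integral_mono ((h.bm_Y hA hV t m i).integrable P) (integrable_const C)
      fun ω => h.queueY_le hA hV t ω m i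
    simpa using this
  have h4 : (∫ ω, N.queueY p η t ω m i ∂P) / t ≤ C / t := by gcongr
  have h5 := (timeAvg_mem_Icc (P := P) bηs (fun t ω => h.aux_mul_mem t ω m i) t).1
  have h6 := (timeAvg_mem_Icc (P := P) brs (fun t ω => hb.r_mul_mem t ω m i) t).1
  have h7 : 0 ≤ C / t := by positivity
  have h8 := N.U_mono h5 (show 0 ≤ timeAvg P (fun τ ω => p.r τ ω m i * N.size m) t + C / t by
    linarith) (by linarith)
  have h9 := N.U_add_le h6 h7
  rw [timeAvg_mul_const (f := fun τ ω => p.r τ ω m i)] at h8 h9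
  rw [mul_div_assoc]
  linarith

/-- The time-averaged utility of the algorithm is at least that of any feasible rates, up to the
loss of the drift bound. -/
theorem IsRun.netUtility_ge [IsProbabilityMeasure P]
    (hW : ∀ i : E, ∃ b : E → Fin W, i ∈ N.control (fun j => (b j : ℕ)))
    (h : N.IsRun P A W V T ℱ p η) (hA : N.IsArrivals P A) (hV : 0 < V) (hT : N.maxSize ≤ T)
    {c : ℝ} (hc : 0 ≤ c) (hcT : c * T ≤ (T : ℝ) - N.maxSize + 1) {ρ dl σ : M → E → ℝ}
    (hR : N.IsRatePoint (meanArrival P A) c 0 ρ dl σ) :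
    N.rateUtility ρ dl - N.slotLoss T / V ≤ N.netUtility P p := by
  have hT0 : 0 < T := N.one_le_maxSize.trans hT
  have hb := h.isBounded hA
  set u := N.rateUtility ρ dl - N.slotLoss T / V
  set F : ℕ → ℝ := fun t => ∫ ω, N.slotUtility p η t ω ∂P
  set D₁ := ∑ m, ∑ i, N.β * N.dmax m i * N.size m
  -- incomplete super slots matter only by a constant
  have hF : ∀ t, -D₁ ≤ F t := by
    intro t
    have h1 : ∀ ω, -D₁ ≤ N.slotUtility p η t ω := by
      intro ω
      simp only [D₁, ← Finset.sum_neg_distrib]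
      refine Finset.sum_le_sum fun m _ => Finset.sum_le_sum fun i _ => ?_
      have h2 := N.U_nonneg _ (h.aux_mul_mem t ω m i).1
      have h3 := (hb.d_mul_mem t ω m i).2
      have h4 := N.β_pos
      rw [mul_assoc, mul_assoc]
      nlinarith
    have h2 := integral_mono (integrable_const _) ((h.bm_slotUtility hA t).integrable P) h1
    simpa using h2
  have hsum : ∀ t : ℕ, t * u - T * (|u| + |D₁|) ≤ ∑ τ ∈ Finset.range t, F τ := by
    intro t
    have h1 := h.sum_slotUtility_ge hW hA hV hT hc hcT hR (t / T)
    have h2 : V * N.rateUtility ρ dl - N.slotLoss T = V * u := by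
      simp only [u]; field_simp
    rw [h2, mul_left_comm] at h1
    replace h1 := le_of_mul_le_mul_left h1 hV
    have h3 : t = t / T * T + t % T := (Nat.div_add_mod' t T).symm
    have h4 : ∑ τ ∈ Finset.range t, F τ = ∑ τ ∈ Finset.range (t / T * T), F τ
        + ∑ j ∈ Finset.range (t % T), F (t / T * T + j) := by
      rw [← Finset.sum_range_add, ← h3]
    have h5 : (t % T : ℕ) * (-D₁) ≤ ∑ j ∈ Finset.range (t % T), F (t / T * T + j) := by
      have := Finset.card_nsmul_le_sum (Finset.range (t % T)) (fun j => F (t / T * T + j)) (-D₁)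
        fun j _ => hF _
      simpa using this
    have h6 : ((t % T : ℕ) : ℝ) * (u + D₁) ≤ T * (|u| + |D₁|) := by
      have h7 : ((t % T : ℕ) : ℝ) ≤ T := by exact_mod_cast (Nat.mod_lt t hT0).le
      have h8 : u + D₁ ≤ |u| + |D₁| := add_le_add (le_abs_self _) (le_abs_self _)
      calc ((t % T : ℕ) : ℝ) * (u + D₁) ≤ (t % T : ℕ) * (|u| + |D₁|) := by gcongr
        _ ≤ T * (|u| + |D₁|) := by gcongr
    have h9 : (t : ℝ) = (t / T * T : ℕ) + (t % T : ℕ) := by exact_mod_cast h3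
    rw [h4, h9]
    linarith
  set C₂ := ∑ m, ∑ i : E, derivWithin N.U (Ici 0) 0 *
        (V * derivWithin N.U (Ici 0) 0 + N.Amax m i * N.size m)
  set K := T * (|u| + |D₁|) + C₂
  have hH : ∀ t : ℕ, t ≠ 0 → u - K / t ≤ N.horizonUtility P p t := by
    intro t ht
    have hpos : (0 : ℝ) < t := by positivity
    have h1 := h.timeAvg_slotUtility_le hA hV ht
    have h2 : u - T * (|u| + |D₁|) / t ≤ timeAvg P (N.slotUtility p η) t := by
      rw [timeAvg, one_div, inv_mul_eq_div, le_div_iff₀ hpos, sub_mul, div_mul_cancel₀ _ hpos.ne']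
      linarith [hsum t]
    simp only [K, add_div]
    linarith
  have hlim : Tendsto (fun t : ℕ => u - K / (t : ℝ)) atTop (nhds u) := by
    simpa using (tendsto_const_nhds (x := u)).sub (tendsto_const_div_atTop_nhds_zero_nat K)
  rw [← hlim.liminf_eq]
  refine liminf_le_liminf ?_ hlim.isBoundedUnder_ge ?_
  · filter_upwards [eventually_ne_atTop 0] with t ht using hH t ht
  · have hbd := hb.horizonUtility_bounded (P := P) (fun t m i => h.bm_r hA t m i)
      fun t m i => h.bm_d hA t m i
    exact (isBoundedUnder_of ⟨_, fun t => (hbd t).2⟩ :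
      IsBoundedUnder (· ≤ ·) atTop (N.horizonUtility P p)).isCoboundedUnder_ge

end Run

end Network

/-! ### Rates of offline policies -/

namespace Network

variable {Ω M E : Type*}

section Offline

variable [Fintype M] [MeasurableSpace Ω] {N : Network M E} {P : Measure Ω}
  {A : ℕ → Ω → M → E → ℝ} {ν : ℝ} {p : Policy Ω M E}

theorem IsOffline.isBounded (h : N.IsOffline P A ν p) (hA : N.IsArrivals P A) :
    N.IsBounded p where
  admission t ω m i := ⟨(h.admission t ω m i).1, (h.admission t ω m i).2.trans (hA.le_max t ω m i)⟩
  drop := h.drop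

theorem IsOffline.bm_r (h : N.IsOffline P A ν p) (hA : N.IsArrivals P A) (t : ℕ) (m : M) (i : E) :
    BoundedMeasurable fun ω => p.r t ω m i :=
  .of_mem_Icc (h.measurable_r t m i) fun ω => (h.isBounded hA).admission t ω m i

theorem IsOffline.bm_d (h : N.IsOffline P A ν p) (t : ℕ) (m : M) (i : E) :
    BoundedMeasurable fun ω => p.d t ω m i :=
  .of_mem_Icc (h.measurable_d t m i) fun ω => h.drop t ω m i

theorem IsOffline.bm_mu (h : N.IsOffline P A ν p) (t : ℕ) (m : M) (i : E) :
    BoundedMeasurable fun ω => p.mu t ω m i :=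
  .of_mem_Icc (Measurable.ite (h.measurable_serve t i (some m)) measurable_const measurable_const)
    fun ω => ⟨p.mu_nonneg t ω m i, p.mu_le_one t ω m i⟩

theorem IsOffline.bm_Q (h : N.IsOffline P A ν p) (hA : N.IsArrivals P A) (hν : ν ≤ 1) (t : ℕ)
    (m : M) (i : E) : BoundedMeasurable fun ω => N.queueQ (1 - ν) p t ω m i := by
  refine .of_mem_Icc ?_ fun ω => ⟨(h.isBounded hA).queueQ_nonneg _ t ω m i,
    (h.isBounded hA).queueQ_le (sub_nonneg.2 hν) t ω m i⟩
  induction t with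
  | zero => exact measurable_const
  | succ t ih =>
    simp only [queueQ_succ]
    exact (((ih.sub ((h.bm_mu t m i).measurable.const_mul _)).sub
      ((h.measurable_d t m i).mul_const _)).max measurable_const).add
        ((h.measurable_r t m i).mul_const _)

/-- Dropping as much as possible and admitting nothing is an offline policy. -/
theorem exists_isOffline [IsProbabilityMeasure P] (hA : N.IsArrivals P A) (ν : ℝ) :
    ∃ p : Policy Ω M E, N.IsOffline P A ν p := by
  classical
  set p : Policy Ω M E :=
    ⟨fun _ _ _ _ => 0, fun _ _ m i => N.dmax m i, fun _ _ => ∅, fun _ _ _ => none⟩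
  have hμ : ∀ t ω m i, p.mu t ω m i = 0 := fun t ω m i => by simp [Policy.mu, p]
  have hQ : ∀ t ω m i, N.queueQ (1 - ν) p t ω m i = 0 := by
    intro t ω m i
    induction t with
    | zero => rfl
    | succ t ih =>
      have := mul_nonneg (N.dmax_nonneg m i) (Nat.cast_nonneg (α := ℝ) (N.size m))
      rw [queueQ_succ, ih, hμ]
      simp only [p]
      rw [max_eq_right (by linarith)]
      simp
  refine ⟨p, ⟨fun _ _ _ => measurable_const, fun _ _ _ => measurable_const,
    fun _ χ => .const (∅ = χ), fun _ _ o => .const (none = o),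
    fun t ω m i => ⟨le_rfl, hA.nonneg t ω m i⟩,
    fun t ω m i => ⟨N.dmax_nonneg m i, le_rfl⟩, fun _ _ => N.feasible_empty, ?_, ?_, ?_⟩⟩
  · intro t ω i
    simp [hμ, p]
  · intro m i
    refine isBoundedUnder_of ⟨0, fun t => ?_⟩
    simp [timeAvg, hQ]
  · intro m i
    have h1 : Tendsto (timeAvg P fun τ ω => (1 - ν) * p.mu τ ω m i + p.d τ ω m i * N.size m) atTop
        (nhds (N.dmax m i * N.size m)) := by
      refine tendsto_const_nhds.congr' ?_
      filter_upwards [eventually_ne_atTop 0] with t ht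
      simp only [hμ, mul_zero, zero_add, p]
      rw [timeAvg_const _ ht]
    rw [h1.liminf_eq]
    exact N.eps_le m i

end Offline

section Offline

variable [Fintype M] [Fintype E] [MeasurableSpace Ω] {N : Network M E} {P : Measure Ω}
  {A : ℕ → Ω → M → E → ℝ} {ν : ℝ} {p : Policy Ω M E}

/-- A slack in the rate conditions, and a reduction of the capacity, can be compensated by dropping
more jobs. -/
theorem IsRatePoint.exists_drop {a : M → E → ℝ} (ha : ∀ m i, a m i ≤ N.Amax m i) {c c' e : ℝ}
    (hc' : 0 ≤ c') (hc : c' ≤ c) (he : 0 ≤ e) {ρ dl σ : M → E → ℝ}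
    (hR : N.IsRatePoint a c e ρ dl σ) :
    ∃ dl', N.IsRatePoint a c' 0 ρ dl' σ ∧ N.rateUtility ρ dl
      - N.β * (e + (c - c')) * (Fintype.card M * Fintype.card E) ≤ N.rateUtility ρ dl' := by
  set e' := e + (c - c')
  have he' : 0 ≤ e' := add_nonneg he (sub_nonneg.2 hc)
  have hs : ∀ m, (0 : ℝ) < N.size m := fun m => lt_of_lt_of_le one_pos (N.one_le_size m)
  refine ⟨fun m i => min (dl m i + e' / N.size m) (N.dmax m i), ⟨hR.admission, ?_,
    hR.service_nonneg, hR.service_le, ?_, ?_⟩, ?_⟩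
  · intro m i
    have h1 := (hR.drop m i).1
    have h2 := hs m
    exact ⟨le_min (by positivity) (N.dmax_nonneg m i), min_le_right _ _⟩
  · intro m i
    have h2 := hs m
    have h3 := mul_nonneg hc' (hR.service_nonneg m i)
    have h4 : (c - c') * σ m i ≤ c - c' :=
      mul_le_of_le_one_right (sub_nonneg.2 hc) (hR.service_le_one m i)
    rw [min_mul_of_nonneg _ _ h2.le, add_mul, div_mul_cancel₀ _ h2.ne', add_zero,
      ← sub_le_iff_le_add']
    refine le_min ?_ ?_
    · have := hR.rate m i
      simp only [e']
      linarith
    · have h5 : ρ m i * N.size m ≤ N.Amax m i * N.size m := by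
        have := (hR.admission m i).2.trans (ha m i)
        gcongr
      have := N.Amax_mul_le m i
      linarith
  · intro m i
    have h2 := hs m
    have h3 := mul_nonneg hc' (hR.service_nonneg m i)
    have h4 : (c - c') * σ m i ≤ c - c' :=
      mul_le_of_le_one_right (sub_nonneg.2 hc) (hR.service_le_one m i)
    rw [min_mul_of_nonneg _ _ h2.le, add_mul, div_mul_cancel₀ _ h2.ne', add_zero,
      ← sub_le_iff_le_add']
    refine le_min ?_ ?_
    · have := hR.delay m i
      simp only [e']
      linarith
    · have := N.eps_le m i
      linarith
  · have h1 : N.β * e' * (Fintype.card M * Fintype.card E) = ∑ _m : M, ∑ _i : E, N.β * e' := by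
      simp only [Finset.sum_const, Finset.card_univ, nsmul_eq_mul]
      ring
    rw [h1]
    unfold rateUtility
    rw [← Finset.sum_sub_distrib]
    refine Finset.sum_le_sum fun m _ => ?_
    rw [← Finset.sum_sub_distrib]
    refine Finset.sum_le_sum fun i _ => ?_
    have h2 := hs m
    have hβ := N.β_pos
    have h3 : N.β * min (dl m i + e' / N.size m) (N.dmax m i) * N.size m ≤
        N.β * (dl m i + e' / N.size m) * N.size m := by
      gcongr
      exact min_le_left _ _
    have h4 : N.β * (dl m i + e' / N.size m) * N.size m = N.β * dl m i * N.size m + N.β * e' := by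
      field_simp
    linarith

/-- The average service rates of an offline policy are dominated by the collision-free schedules. -/
theorem IsOffline.timeAvg_mu_le [IsProbabilityMeasure P] (h : N.IsOffline P A ν p) {w : E → ℝ}
    (hw : ∀ i, 0 ≤ w i) {K : ℝ} (hK : ∀ χ, N.Feasible χ → ∑ i ∈ χ, w i ≤ K) (t : ℕ) :
    ∑ m, ∑ i, w i * timeAvg P (fun τ ω => p.mu τ ω m i) t ≤ K := by
  classical
  have hb : ∀ m i t, BoundedMeasurable fun ω => w i * p.mu t ω m i := fun m i t =>
    (BoundedMeasurable.const _).mul (h.bm_mu t m i)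
  have h1 : ∀ t ω, ∑ m, ∑ i, w i * p.mu t ω m i = ∑ i ∈ p.x t ω, w i := by
    intro t ω
    rw [Finset.sum_comm]
    simp only [← Finset.mul_sum, h.unit_capacity]
    simp
  have h2 := timeAvg_sum₂ (P := P) (f := fun m i t ω => w i * p.mu t ω m i) hb t
  simp only [timeAvg_const_mul] at h2
  rw [← h2]
  refine (timeAvg_mem_Icc (b := K) (fun t => .sum₂ fun m i => hb m i t) (fun t ω => ?_) t).2
  rw [h1]
  exact ⟨Finset.sum_nonneg fun i _ => hw i, hK _ (h.collision_free t ω)⟩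

/-- After a long time, the average rates of an offline policy are feasible up to a small slack. -/
theorem IsOffline.eventually_isRatePoint [IsProbabilityMeasure P] (h : N.IsOffline P A ν p)
    (hA : N.IsArrivals P A) (hν : ν ≤ 1) {e : ℝ} (he : 0 < e) :
    ∀ᶠ t in atTop, N.IsRatePoint (meanArrival P A) (1 - ν) e
      (fun m i => timeAvg P (fun τ ω => p.r τ ω m i) t)
      (fun m i => timeAvg P (fun τ ω => p.d τ ω m i) t)
      (fun m i => timeAvg P (fun τ ω => p.mu τ ω m i) t) := by
  have hb := h.isBounded hA
  have hν' : 0 ≤ 1 - ν := sub_nonneg.2 hν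
  have bμ : ∀ m i t, BoundedMeasurable fun ω => (1 - ν) * p.mu t ω m i := fun m i t =>
    (BoundedMeasurable.const _).mul (h.bm_mu t m i)
  have br : ∀ m i t, BoundedMeasurable fun ω => p.r t ω m i * N.size m := fun m i t =>
    (h.bm_r hA t m i).mul (.const _)
  have bd : ∀ m i t, BoundedMeasurable fun ω => p.d t ω m i * N.size m := fun m i t =>
    (h.bm_d t m i).mul (.const _)
  have hQ : ∀ m i, ∀ᶠ t : ℕ in atTop, (∫ ω, N.queueQ (1 - ν) p t ω m i ∂P) / t ≤ e := by
    intro m i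
    obtain ⟨C, hC⟩ := h.stable m i
    refine eventually_le_mul_of_avg_le (N.Amax_mul_nonneg m i) (by simp [queueQ])
      (fun t => integral_nonneg fun ω => hb.queueQ_nonneg _ t ω m i) (fun t => ?_)
      (eventually_map.1 hC) he
    have := integral_mono ((h.bm_Q hA hν (t + 1) m i).integrable P)
      (((h.bm_Q hA hν t m i).add (.const _)).integrable P)
      fun ω => hb.queueQ_succ_le hν' t ω m i
    rwa [integral_add ((h.bm_Q hA hν t m i).integrable P) (integrable_const _), integral_const,
      probReal_univ, one_smul] at this
  have hD : ∀ m i, ∀ᶠ t : ℕ in atTop, N.eps m i - e < timeAvg P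
      (fun τ ω => (1 - ν) * p.mu τ ω m i + p.d τ ω m i * N.size m) t := by
    intro m i
    refine eventually_lt_of_lt_liminf (by linarith [h.persistent m i])
      (isBoundedUnder_of ⟨0, fun t => ?_⟩)
    refine (timeAvg_mem_Icc (b := (1 - ν) + N.dmax m i * N.size m)
      (fun t => (bμ m i t).add (bd m i t)) (fun t ω => ?_) t).1
    have h1 := p.mu_nonneg t ω m i
    have h2 := mul_le_of_le_one_right hν' (p.mu_le_one t ω m i)
    obtain ⟨h3, h4⟩ := hb.d_mul_mem t ω m i
    exact ⟨by positivity, by linarith⟩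
  filter_upwards [eventually_all.2 fun m => eventually_all.2 fun i => hQ m i,
    eventually_all.2 fun m => eventually_all.2 fun i => hD m i, eventually_ne_atTop 0]
    with t hQt hDt ht
  refine ⟨fun m i => ⟨?_, ?_⟩, fun m i => ?_, fun m i => ?_, fun w hw K hK => ?_, fun m i => ?_,
    fun m i => ?_⟩
  · exact (timeAvg_mem_Icc (fun t => h.bm_r hA t m i) (fun t ω => hb.admission t ω m i) t).1
  · have h1 := timeAvg_mono (P := P) (fun t => h.bm_r hA t m i)
      (fun t => hA.boundedMeasurable t m i) (fun t ω => (h.admission t ω m i).2) t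
    have h2 : timeAvg P (fun τ ω => A τ ω m i) t = meanArrival P A m i := by
      simp [timeAvg, hA.integral_eq, ht]
    exact h1.trans_eq h2
  · exact timeAvg_mem_Icc (fun t => h.bm_d t m i) (fun t ω => h.drop t ω m i) t
  · exact (timeAvg_mem_Icc (b := 1) (fun t => h.bm_mu t m i)
      (fun t ω => ⟨p.mu_nonneg t ω m i, p.mu_le_one t ω m i⟩) t).1
  · exact h.timeAvg_mu_le hw hK t
  · have h1 := timeAvg_le_of_increment (P := P) (q := fun t ω => N.queueQ (1 - ν) p t ω m i)
      (f := fun t ω => p.r t ω m i * N.size m - (1 - ν) * p.mu t ω m i - p.d t ω m i * N.size m)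
      (fun ω => rfl) (fun t => ((br m i t).sub (bμ m i t)).sub (bd m i t))
      (fun t => h.bm_Q hA hν t m i) (fun t ω => by
        rw [queueQ_succ]
        linarith [le_max_left (N.queueQ (1 - ν) p t ω m i - (1 - ν) * p.mu t ω m i
          - p.d t ω m i * N.size m) 0]) t
    rw [timeAvg_sub (fun t => (br m i t).sub (bμ m i t)) (bd m i), timeAvg_sub (br m i) (bμ m i),
      timeAvg_mul_const, timeAvg_mul_const, timeAvg_const_mul] at h1
    linarith [hQt m i]
  · have h1 := hDt m i
    rw [timeAvg_add (bμ m i) (bd m i), timeAvg_mul_const, timeAvg_const_mul] at h1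
    linarith

end Offline

theorem B_nonneg [Fintype M] [Fintype E] (N : Network M E) : 0 ≤ N.B :=
  mul_nonneg (by norm_num) (Finset.sum_nonneg fun m _ => Finset.sum_nonneg fun i _ => by positivity)

theorem B'_nonneg [Fintype M] [Fintype E] (N : Network M E) : 0 ≤ N.B' :=
  Finset.sum_nonneg fun i _ => Finset.sum_nonneg fun m _ => by
    have := N.dmax_nonneg m i
    have := N.Amax_nonneg m i
    positivity

theorem B''_nonneg [Fintype M] [Fintype E] (N : Network M E) : 0 ≤ N.B'' :=
  Finset.sum_nonneg fun m _ => Finset.sum_nonneg fun i _ => by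
    have := N.dmax_nonneg m i
    positivity

theorem slotLoss_le [Fintype M] [Nonempty M] [Fintype E] (N : Network M E) {T : ℕ}
    (hT : N.maxSize ≤ T) : N.slotLoss T ≤ T * (N.B + N.B' + N.B'') := by
  have hB := N.B_nonneg
  have hB' := N.B'_nonneg
  have hB'' := N.B''_nonneg
  have h1 : (1 : ℝ) ≤ N.maxSize := by exact_mod_cast N.one_le_maxSize
  have h2 : (N.maxSize : ℝ) ≤ T := by exact_mod_cast hT
  have h3 : N.B' * (((T : ℝ) - N.maxSize + 1) * ((T : ℝ) - N.maxSize)) / (2 * T) ≤ T * N.B' := by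
    rw [div_le_iff₀ (by linarith)]
    have h4 : ((T : ℝ) - N.maxSize + 1) * ((T : ℝ) - N.maxSize) ≤ T * T :=
      mul_le_mul (by linarith) (by linarith) (by linarith) (by linarith)
    nlinarith [mul_le_mul_of_nonneg_left h4 hB', mul_nonneg hB' (mul_self_nonneg (T : ℝ))]
  have h5 : ((T : ℝ) - 1) / 2 * N.B'' ≤ T * N.B'' := by gcongr; linarith
  have h6 : N.B ≤ T * N.B := le_mul_of_one_le_left hB (by linarith)
  unfold slotLoss
  linarith

/-- The algorithm against the offline optimum, when the latter uses the fraction `1 - ν` of the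
capacity and the former is compared at the fraction `c`. -/
theorem IsRun.offlineOpt_le [Fintype M] [Nonempty M] [Fintype E] [mΩ : MeasurableSpace Ω]
    {N : Network M E} {P : Measure Ω} [IsProbabilityMeasure P] {A : ℕ → Ω → M → E → ℝ} {W : ℕ}
    (hW : ∀ i : E, ∃ b : E → Fin W, i ∈ N.control (fun j => (b j : ℕ))) {V : ℝ} {T : ℕ}
    {ℱ : Filtration ℕ mΩ} {p : Policy Ω M E} {η : ℕ → Ω → M → E → ℝ}
    (h : N.IsRun P A W V T ℱ p η) (hA : N.IsArrivals P A) (hV : 0 < V) (hT : N.maxSize ≤ T)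
    {c ν : ℝ} (hc : 0 ≤ c) (hcT : c * T ≤ (T : ℝ) - N.maxSize + 1) (hcν : c ≤ 1 - ν) :
    N.offlineOpt P A ν ≤ N.netUtility P p + N.slotLoss T / V
      + N.β * (1 - ν - c) * (Fintype.card M * Fintype.card E) := by
  obtain ⟨p₀, hp₀⟩ := exists_isOffline (N := N) hA ν
  refine csSup_le ⟨_, p₀, hp₀, rfl⟩ ?_
  rintro u ⟨q, hq, rfl⟩
  set G : ℝ := Fintype.card M * Fintype.card E
  have hG : 0 ≤ G := by positivity
  have hβ := N.β_pos
  have hbd := (hq.isBounded hA).horizonUtility_bounded (P := P) (fun t m i => hq.bm_r hA t m i)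
    fun t m i => hq.bm_d t m i
  have hcob : IsCoboundedUnder (· ≤ ·) atTop (N.horizonUtility P q) :=
    (isBoundedUnder_of ⟨_, fun t => (hbd t).1⟩ :
      IsBoundedUnder (· ≥ ·) atTop (N.horizonUtility P q)).isCoboundedUnder_le
  refine le_of_forall_pos_le_add fun κ hκ => ?_
  -- a horizon at which the utility is nearly optimal and the rates are nearly feasible
  set e := κ / (1 + N.β * G)
  have he : 0 < e := by positivity
  have hfreq := frequently_lt_of_lt_limsup hcob
    (show limsup (N.horizonUtility P q) atTop - e < limsup (N.horizonUtility P q) atTop by linarith)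
  obtain ⟨t, ht, hR⟩ := (hfreq.and_eventually
    (hq.eventually_isRatePoint hA (by linarith) he)).exists
  obtain ⟨dl', hR', hval⟩ := hR.exists_drop hA.meanArrival_le hc hcν he.le
  have hfin := h.netUtility_ge hW hA hV hT hc hcT hR'
  have hκe : κ = e + N.β * e * G := by simp only [e]; field_simp
  change N.horizonUtility P q t - _ ≤ _ at hval
  linarith

end Network

/-! ### Utility-optimality -/

theorem mainTheorem1 {Ω M E : Type*} [Fintype M] [Nonempty M] [Fintype E]
    [mΩ : MeasurableSpace Ω] (P : Measure Ω) [IsProbabilityMeasure P]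
    (N : Network M E) (W : ℕ)
    (hW : ∀ i : E, ∃ b : E → Fin W, i ∈ N.control (fun j => (b j : ℕ)))
    (A : ℕ → Ω → M → E → ℝ) (hA : N.IsArrivals P A) :
    (∀ (V : ℝ) (T : ℕ), 0 < V → N.maxSize ≤ T →
      ∀ (ℱ : Filtration ℕ mΩ) (p : Policy Ω M E) (η : ℕ → Ω → M → E → ℝ),
      N.IsRun P A W V T ℱ p η →
      ∀ δ θ ν : ℝ, 0 < δ → δ < 1 → 0 < θ → θ < 1 →
      ν = 1 - (1 - δ) * (1 - θ) * ((T : ℝ) - N.maxSize + 1) / T →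
      N.netUtility P p ≥ N.offlineOpt P A ν
        - ((T : ℝ) - 1) / (2 * V) * N.B''
        - N.B' * (((T : ℝ) - N.maxSize + 1) * ((T : ℝ) - N.maxSize)) / (2 * V * T)
        - N.B / V) ∧
    (∀ κ : ℝ, 0 < κ → ∃ (V₀ : ℝ) (T₀ : ℕ) (c : ℝ), 0 < c ∧
      ∀ (V : ℝ) (T : ℕ), 0 < V → N.maxSize ≤ T → V₀ ≤ V → T₀ ≤ T → (T : ℝ) / V ≤ c →
      ∀ (ℱ : Filtration ℕ mΩ) (p : Policy Ω M E) (η : ℕ → Ω → M → E → ℝ),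
      N.IsRun P A W V T ℱ p η →
      N.netUtility P p ≥ N.offlineOpt P A 0 - κ) := by
  have hβ := N.β_pos
  have hm1 : (1 : ℝ) ≤ N.maxSize := by exact_mod_cast N.one_le_maxSize
  refine ⟨?_, ?_⟩
  · intro V T hV hT ℱ p η h δ θ ν hδ0 hδ1 hθ0 hθ1 hν
    have hmT : (N.maxSize : ℝ) ≤ T := by exact_mod_cast hT
    have hT0 : (0 : ℝ) < T := by linarith
    have hS : (0 : ℝ) ≤ (T : ℝ) - N.maxSize + 1 := by linarith
    have h0 : 0 ≤ (1 - δ) * (1 - θ) := mul_nonneg (by linarith) (by linarith)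
    have h1 : (1 - δ) * (1 - θ) ≤ 1 := mul_le_one₀ (by linarith) (by linarith) (by linarith)
    have hc : 1 - ν = (1 - δ) * (1 - θ) * ((T : ℝ) - N.maxSize + 1) / T := by rw [hν]; ring
    have hcT : (1 - ν) * T ≤ (T : ℝ) - N.maxSize + 1 := by
      rw [hc, div_mul_cancel₀ _ hT0.ne']
      exact mul_le_of_le_one_left hS h1
    have hmain := h.offlineOpt_le hW hA hV hT (by rw [hc]; positivity) hcT le_rfl
    have hloss : N.slotLoss T / V = ((T : ℝ) - 1) / (2 * V) * N.B''
        + N.B' * (((T : ℝ) - N.maxSize + 1) * ((T : ℝ) - N.maxSize)) / (2 * V * T) + N.B / V := by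
      unfold Network.slotLoss
      field_simp
      ring
    simp only [sub_self, mul_zero, zero_mul, add_zero, hloss] at hmain
    linarith
  · intro κ hκ
    set G : ℝ := Fintype.card M * Fintype.card E
    have hG : 0 ≤ G := by positivity
    set C : ℝ := N.B + N.B' + N.B''
    have hC : 0 ≤ C := add_nonneg (add_nonneg N.B_nonneg N.B'_nonneg) N.B''_nonneg
    refine ⟨0, ⌈N.β * N.maxSize * G / (κ / 2)⌉₊, κ / 2 / (C + 1), by positivity, ?_⟩
    intro V T hV hT _ hT₀ hTV ℱ p η h
    have hmT : (N.maxSize : ℝ) ≤ T := by exact_mod_cast hT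
    have hT0 : (0 : ℝ) < T := by linarith
    have hS : (0 : ℝ) ≤ (T : ℝ) - N.maxSize + 1 := by linarith
    -- the fraction of the slots in which jobs of all types can be started
    set c := ((T : ℝ) - N.maxSize + 1) / T
    have hcT : c * T = (T : ℝ) - N.maxSize + 1 := div_mul_cancel₀ _ hT0.ne'
    have hc1 : c ≤ 1 - 0 := by
      rw [sub_zero, div_le_one hT0]; linarith
    have hmain := h.offlineOpt_le hW hA hV hT (by positivity : 0 ≤ c) hcT.le hc1
    have h1 : N.slotLoss T / V ≤ κ / 2 := by
      calc N.slotLoss T / V ≤ T * C / V := by gcongr; exact N.slotLoss_le hT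
        _ = T / V * C := by ring
        _ ≤ κ / 2 / (C + 1) * C := by gcongr
        _ ≤ κ / 2 := by
          rw [div_mul_eq_mul_div, div_le_iff₀ (by positivity)]
          nlinarith
    have h2 : N.β * (1 - 0 - c) * G ≤ κ / 2 := by
      have h3 : 1 - 0 - c ≤ N.maxSize / T := by
        rw [le_div_iff₀ hT0, sub_mul, hcT]; linarith
      have h4 : N.β * N.maxSize * G / (κ / 2) ≤ T := Nat.ceil_le.1 hT₀
      rw [div_le_iff₀ (by positivity)] at h4
      calc N.β * (1 - 0 - c) * G ≤ N.β * (N.maxSize / T) * G := by gcongr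
        _ = N.β * N.maxSize * G / T := by ring
        _ ≤ κ / 2 := by rw [div_le_iff₀ hT0]; linarith
    linarith
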